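/- Semigroups are nonempty. For a semigroup $S$ let $1=S\times S$ and $0$ (equality) be its largest and smallest congruences. For congruences $\alpha_1,\dots,\alpha_n$ of $S$ ($n\ge 1$), let $M(\alpha_1,\dots,\alpha_n)$ be the subsemigroup of $S^{\{0,1\}^n}$ (with pointwise multiplication) generated by all functions of the form $v\mapsto a$ if $v_i=0$, $v\mapsto b$ if $v_i=1$, where $1\le i\le n$ and $(a,b)\in\alpha_i$. The commutator $[\alpha_1,\dots,\alpha_n]$ is the smallest congruence $\delta$ of $S$ such that every $x\in M(\alpha_1,\dots,\alpha_n)$ satisfies: if $(x(r,0),x(r,1))\in\delta$ for all $r\in\{0,1\}^{n-1}\setminus\{(1,\dots,1)\}$, then $(x(1,\dots,1,0),x(1,\dots,1,1))\in\delta$. (For $n=2$ this is the binary term condition commutator.) Put $$[1]^0:=1,\quad [1]^{d+1}:=[[1]^d,[1]^d];\qquad (1]^1:=1,\quad (1]^{d+1}:=[1,(1]^{d}];\qquad [1)^1:=1,\quad [1)^{d+1}:=[[1)^{d},1].$$ The semigroup $S$ is *solvable* if $[1]^d=0$ for some $d\ge 0$, *left nilpotent* if $(1]^{d+1}=0$ for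 some $d\ge 0$, *right nilpotent* if $[1)^{d+1}=0$ for some $d\ge0$, and *supernilpotent* if $[\underbrace{1,\dots,1}_{d+1}]=0$ for some $d\ge 0$. It is *eventually regular* if for every $a\in S$ there are $n\ge 1$ and $b\in S$ with $a^nba^n=a^n$. It is a *nilpotent extension* of $K$ if $K$ is a (nonempty, two-sided) ideal of $S$ and there is $m\ge 1$ such that every product of $m$ elements of $S$ lies in $K$. A semigroup is *completely simple* if it has no ideal other than itself and has a primitive idempotent, that is, an idempotent which is minimal among the idempotents in the order $e\le f\iff ef=fe=e$. A *subgroup* of a semigroup is a subsemigroup that is a group; solvable and nilpotent have their classical meaning for groups. **Corollary 1.2.** Let $S$ be an eventually regular semigroup. 1. $S$ is solvable if and only if $S$ is a nilpotent extension of a completely simple semigroup all of whose subgroups are solvable. 2. The following are equivalent: (a) $S$ is left nilpotent; (b) $S$ is right nilpotent; (c) $S$ is supernilpotent; (d) $S$ is a nilpotent extension of a completely simple semigroup all of whose subgroups are nilpotent. -/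

import Mathlib

universe u

namespace SemigroupCommutator

section Commutator

variable {S : Type u} [Semigroup S]

/-- `M(α, β)`: the subsemigroup of the semigroup of `2 × 2` arrays over `S` (with pointwise
multiplication) generated by the arrays with rows `(a, a), (b, b)` for `(a, b) ∈ α` and the arrays
with rows `(c, d), (c, d)` for `(c, d) ∈ β`. The entry in row `i`, column `j` of `x` is `x i j`. -/
def termArrays (α β : Con S) : Subsemigroup (Fin 2 → Fin 2 → S) :=
  Subsemigroup.closure
    ({x | ∃ a b : S, α a b ∧ x = ![![a, a], ![b, b]]} ∪
      {x | ∃ c d : S, β c d ∧ x = ![![c, d], ![c, d]]})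

/-- `C(α, β, δ)`: `α` centralizes `β` modulo `δ`. -/
def Centralizes (α β δ : Con S) : Prop :=
  ∀ x ∈ termArrays α β, δ (x 0 0) (x 0 1) → δ (x 1 0) (x 1 1)

/-- The binary term condition commutator `[α, β]`: the smallest congruence `δ` with `C(α, β, δ)`
(it is smallest by `commutator_isLeast`). -/
def commutator (α β : Con S) : Con S :=
  sInf {δ : Con S | Centralizes α β δ}

theorem commutator_isLeast (α β : Con S) :
    IsLeast {δ : Con S | Centralizes α β δ} (commutator α β) := by
  refine ⟨fun x hx h => ?_, fun δ hδ => sInf_le hδ⟩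
  intro δ hδ
  exact hδ x hx (h δ hδ)

/-- The cube version of `M(α₁, …, αₙ₊₁)`: the subsemigroup of functions on `{0, 1}ⁿ⁺¹` (with
pointwise multiplication) generated by the functions that take the value `a` where the `i`-th
coordinate is `0` and `b` where it is `1`, for `(a, b) ∈ αᵢ`. Such a function is a `2ⁿ × 2` array:
the first `n` coordinates index the row, the last one the column. -/
def termCubes {n : ℕ} (α : Fin (n + 1) → Con S) : Subsemigroup ((Fin (n + 1) → Bool) → S) :=
  Subsemigroup.closure
    {x | ∃ (i : Fin (n + 1)) (a b : S), α i a b ∧ x = fun v => if v i then b else a}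

/-- The higher term condition modulo `δ`: if in every row but the last the two entries are
`δ`-related, then so are the two entries in the last row, whose index is `(1, …, 1)`. -/
def HigherCentralizes {n : ℕ} (α : Fin (n + 1) → Con S) (δ : Con S) : Prop :=
  ∀ x ∈ termCubes α,
    (∀ r : Fin n → Bool, r ≠ (fun _ => true) →
      δ (x (Fin.snoc r false)) (x (Fin.snoc r true))) →
    δ (x (Fin.snoc (fun _ => true) false)) (x (Fin.snoc (fun _ => true) true))

/-- The `(n + 1)`-ary commutator `[α₁, …, αₙ₊₁]`: the smallest congruence that satisfies the higher
term condition (it is smallest by `higherCommutator_isLeast`). -/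
def higherCommutator {n : ℕ} (α : Fin (n + 1) → Con S) : Con S :=
  sInf {δ : Con S | HigherCentralizes α δ}

theorem higherCommutator_isLeast {n : ℕ} (α : Fin (n + 1) → Con S) :
    IsLeast {δ : Con S | HigherCentralizes α δ} (higherCommutator α) := by
  refine ⟨fun x hx h => ?_, fun δ hδ => sInf_le hδ⟩
  intro δ hδ
  exact hδ x hx (fun r hr => h r hr δ hδ)

variable (S)

/-- `[1]⁰ = 1` and `[1]ᵈ⁺¹ = [[1]ᵈ, [1]ᵈ]`, where `1 = ⊤` is the total congruence. -/
def derivedCon : ℕ → Con S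
  | 0 => ⊤
  | d + 1 => commutator (derivedCon d) (derivedCon d)

/-- `leftSeries S d` is `(1]ᵈ⁺¹ = [1, [1, … [1, 1] … ]]` with `d + 1` entries. -/
def leftSeries : ℕ → Con S
  | 0 => ⊤
  | d + 1 => commutator ⊤ (leftSeries d)

/-- `rightSeries S d` is `[1)ᵈ⁺¹ = [ … [[1, 1], 1], … , 1]` with `d + 1` entries. -/
def rightSeries : ℕ → Con S
  | 0 => ⊤
  | d + 1 => commutator (rightSeries d) ⊤

/-- `S` is `d`-solvable for some `d`; here `⊥` is the equality congruence. -/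
def Solvable : Prop := ∃ d : ℕ, derivedCon S d = ⊥

/-- `S` is left `d`-nilpotent for some `d`. -/
def LeftNilpotent : Prop := ∃ d : ℕ, leftSeries S d = ⊥

/-- `S` is right `d`-nilpotent for some `d`. -/
def RightNilpotent : Prop := ∃ d : ℕ, rightSeries S d = ⊥

/-- `S` is `d`-supernilpotent for some `d`: the commutator of `d + 1` copies of `1` is `0`. -/
def Supernilpotent : Prop :=
  ∃ d : ℕ, higherCommutator (fun _ : Fin (d + 1) => (⊤ : Con S)) = ⊥

end Commutator

section Structure

/-- `powSucc a n` is `aⁿ⁺¹`. -/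
def powSucc {S : Type u} [Semigroup S] (a : S) : ℕ → S
  | 0 => a
  | n + 1 => powSucc a n * a

/-- Every element `a` has a regular power: `aⁿ b aⁿ = aⁿ` for some `n ≥ 1` and some `b`. -/
def EventuallyRegular (S : Type u) [Semigroup S] : Prop :=
  ∀ a : S, ∃ (n : ℕ) (b : S), powSucc a n * b * powSucc a n = powSucc a n

/-- A (two-sided, nonempty) ideal of a semigroup. -/
def IsIdeal {S : Type u} [Semigroup S] (I : Set S) : Prop :=
  I.Nonempty ∧ ∀ s : S, ∀ a ∈ I, s * a ∈ I ∧ a * s ∈ I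

/-- `e` is a primitive idempotent: it is minimal among the idempotents, in the order
`f ≤ e ↔ f * e = f ∧ e * f = f`. -/
def IsPrimitiveIdempotent {S : Type u} [Semigroup S] (e : S) : Prop :=
  e * e = e ∧ ∀ f : S, f * f = f → f * e = f → e * f = f → f = e

/-- `K` is completely simple: it has no ideal other than itself, and it has a primitive
idempotent. -/
def CompletelySimple (K : Type u) [Semigroup K] : Prop :=
  (∀ I : Set K, IsIdeal I → I = Set.univ) ∧ ∃ e : K, IsPrimitiveIdempotent e

/-- All subgroups of `K` (subsemigroups that are groups, that is, images of groups under injective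
semigroup homomorphisms) are solvable groups. -/
def SubgroupsSolvable (K : Type u) [Semigroup K] : Prop :=
  ∀ (G : Type u) [Group G] (f : G →ₙ* K), Function.Injective f → Group.IsSolvable G

/-- All subgroups of `K` are nilpotent groups. -/
def SubgroupsNilpotent (K : Type u) [Semigroup K] : Prop :=
  ∀ (G : Type u) [Group G] (f : G →ₙ* K), Function.Injective f → Group.IsNilpotent G

/-- `prodSet S n` is `Sⁿ⁺¹`, the set of all products of `n + 1` elements of `S`. -/
def prodSet (S : Type u) [Semigroup S] : ℕ → Set S
  | 0 => Set.univ
  | n + 1 => {x | ∃ y ∈ prodSet S n, ∃ z : S, x = y * z}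

/-- `S` is a nilpotent extension of `K`: `K` is an ideal of `S` and `Sᵐ ⊆ K` for some `m ≥ 1`. -/
def IsNilpotentExtensionOf (S : Type u) [Semigroup S] (K : Subsemigroup S) : Prop :=
  IsIdeal (K : Set S) ∧ ∃ n : ℕ, prodSet S n ⊆ (K : Set S)

end Structure

end SemigroupCommutator

/-! Forward direction. If `f ≤ e` are idempotents, the array with entries `f, f, f, e` lies in `M(α,
β)` whenever `α` and `β` both relate `f` to `e`, so `f` and `e` stay related in every iterated
commutator. Each of the four conditions thus makes all idempotents primitive. Eventual regularity
provides an idempotent `e`, and primitivity turns `eSe` into a group and `K = SeS` into a completely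
simple ideal. By `exists_rel_mul`, a product of an element near `K` modulo `α` and one near `K`
modulo `β` is near `K` modulo `[α, β]`; once the series reaches equality, all long products lie in
`K`. For supernilpotence a single cube replaces this induction. The subgroups inherit the condition,
and for groups the term condition commutator contains the usual one.

Converse. An element of `K` is determined by its Rees coordinates `rho`, `proj`, `lam`, and
`proj_mul` is the Rees matrix multiplication. Three families of congruences lead from `1` down to
`0`: the Rees congruences of the ideals `Sᵏ ∪ K`; the congruences `actionCon k` on `K`, which
compare how elements of `K` move under `k` multiplications; and `cosetCon N` for `N` in the derived
or lower central series of `eSe`. Each descent costs one commutator (`biCentralizes_reesCon`,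
`biCentralizes_actionCon`, `biCentralizes_cosetCon`). Since `BiCentralizes` is symmetric, left and
right nilpotence come from the same estimates.

Supernilpotence. A member of `M(1, …, 1)` is a product of functions of one coordinate each. The
outer Rees coordinates of a long product depend on boundedly many coordinates of the cube, and its
group coordinate is a product of functions of at most `D` coordinates (`proj_mem_closure_isLocal`).
Such products lie in the Host–Kra group of the lower central series slowed down by `D`. There a
function that is trivial off one corner takes a value at this corner deep in the series, hence
trivial when the dimension is large. -/

namespace SemigroupCommutator

/-! ### Term conditions and their arrays -/

section General

variable {S : Type u} [Semigroup S] {α β δ α' β' : Con S}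

theorem commutator_centralizes (α β : Con S) : Centralizes α β (commutator α β) :=
  (commutator_isLeast α β).1

theorem commutator_le (h : Centralizes α β δ) : commutator α β ≤ δ :=
  (commutator_isLeast α β).2 h

theorem row_mem_termArrays {a b : S} (h : α a b) : ![![a, a], ![b, b]] ∈ termArrays α β :=
  Subsemigroup.subset_closure (Or.inl ⟨a, b, h, rfl⟩)

theorem col_mem_termArrays {c d : S} (h : β c d) : ![![c, d], ![c, d]] ∈ termArrays α β :=
  Subsemigroup.subset_closure (Or.inr ⟨c, d, h, rfl⟩)

theorem termArrays_induction {P : (x : Fin 2 → Fin 2 → S) → x ∈ termArrays α β → Prop}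
    (row : ∀ a b (h : α a b), P ![![a, a], ![b, b]] (row_mem_termArrays h))
    (col : ∀ c d (h : β c d), P ![![c, d], ![c, d]] (col_mem_termArrays h))
    (mul : ∀ x y hx hy, P x hx → P y hy → P (x * y) (mul_mem hx hy))
    {x : Fin 2 → Fin 2 → S} (hx : x ∈ termArrays α β) : P x hx := by
  induction hx using Subsemigroup.closure_induction with
  | mem x hx =>
    rcases hx with ⟨a, b, h, rfl⟩ | ⟨c, d, h, rfl⟩
    · exact row a b h
    · exact col c d h
  | mul x y hx hy px py => exact mul x y hx hy px py

theorem termArrays_rel {x : Fin 2 → Fin 2 → S} (hx : x ∈ termArrays α β) :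
    (∀ j, α (x 0 j) (x 1 j)) ∧ ∀ i, β (x i 0) (x i 1) := by
  induction hx using termArrays_induction with
  | row a b h =>
    exact ⟨fun j => by fin_cases j <;> exact h, fun i => by fin_cases i <;> exact Con.refl _ _⟩
  | col c d h =>
    exact ⟨fun j => by fin_cases j <;> exact Con.refl _ _, fun i => by fin_cases i <;> exact h⟩
  | mul x y _ _ hx hy =>
    exact ⟨fun j => α.mul (hx.1 j) (hy.1 j), fun i => β.mul (hx.2 i) (hy.2 i)⟩

theorem termArrays_mono (hα : α' ≤ α) (hβ : β' ≤ β) : termArrays α' β' ≤ termArrays α β := by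
  intro x hx
  induction hx using termArrays_induction with
  | row a b h => exact row_mem_termArrays (hα h)
  | col c d h => exact col_mem_termArrays (hβ h)
  | mul x y _ _ hx hy => exact mul_mem hx hy

theorem Centralizes.mono (h : Centralizes α β δ) (hα : α' ≤ α) (hβ : β' ≤ β) :
    Centralizes α' β' δ :=
  fun x hx => h x (termArrays_mono hα hβ hx)

theorem transpose_mem_termArrays {x : Fin 2 → Fin 2 → S} (hx : x ∈ termArrays α β) :
    (fun i j => x j i) ∈ termArrays β α := by
  induction hx using termArrays_induction with
  | row a b h =>
    convert col_mem_termArrays (α := β) h using 1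
    ext i j; fin_cases i <;> fin_cases j <;> rfl
  | col c d h =>
    convert row_mem_termArrays (β := α) h using 1
    ext i j; fin_cases i <;> fin_cases j <;> rfl
  | mul x y _ _ hx hy => exact mul_mem hx hy

/-- Both `C(α, β, δ)` and `C(β, α, δ)`, in terms of `M(α, β)` alone. -/
def BiCentralizes (α β δ : Con S) : Prop :=
  ∀ x ∈ termArrays α β,
    (δ (x 0 0) (x 0 1) → δ (x 1 0) (x 1 1)) ∧ (δ (x 0 0) (x 1 0) → δ (x 0 1) (x 1 1))

theorem BiCentralizes.centralizes (h : BiCentralizes α β δ) : Centralizes α β δ :=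
  fun x hx => (h x hx).1

theorem BiCentralizes.centralizes_swap (h : BiCentralizes α β δ) : Centralizes β α δ :=
  fun _ hx => (h _ (transpose_mem_termArrays hx)).2

theorem bot_rel {a b : S} : (⊥ : Con S) a b ↔ a = b := Iff.rfl

theorem top_rel (a b : S) : (⊤ : Con S) a b := trivial

theorem higherCommutator_centralizes {n : ℕ} (α : Fin (n + 1) → Con S) :
    HigherCentralizes α (higherCommutator α) :=
  (higherCommutator_isLeast α).1

theorem higherCommutator_le {n : ℕ} {α : Fin (n + 1) → Con S} (h : HigherCentralizes α δ) :
    higherCommutator α ≤ δ :=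
  (higherCommutator_isLeast α).2 h

theorem generator_mem_termCubes {n : ℕ} {α : Fin (n + 1) → Con S} (i : Fin (n + 1)) {a b : S}
    (h : α i a b) : (fun v => if v i then b else a) ∈ termCubes α :=
  Subsemigroup.subset_closure ⟨i, a, b, h, rfl⟩

end General

/-! ### Passage to subsemigroups -/

section Subsemigroup

variable {S T : Type u} [Semigroup S] [Semigroup T] (f : T →ₙ* S)

/-- The restriction of a congruence along a homomorphism. -/
abbrev pullback (α : Con S) : Con T := Con.comap f f.map_mul α

theorem map_mem_termArrays {α β : Con T} {α' β' : Con S} (hα : α ≤ pullback f α')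
    (hβ : β ≤ pullback f β') {x : Fin 2 → Fin 2 → T} (hx : x ∈ termArrays α β) :
    (fun i j => f (x i j)) ∈ termArrays α' β' := by
  induction hx using termArrays_induction with
  | row a b h =>
    convert row_mem_termArrays (β := β') (hα h) using 1
    ext i j; fin_cases i <;> fin_cases j <;> rfl
  | col c d h =>
    convert col_mem_termArrays (α := α') (hβ h) using 1
    ext i j; fin_cases i <;> fin_cases j <;> rfl
  | mul x y _ _ hx hy =>
    convert mul_mem hx hy using 1
    ext i j; exact f.map_mul _ _

theorem commutator_le_pullback {α β : Con T} {α' β' : Con S} (hα : α ≤ pullback f α')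
    (hβ : β ≤ pullback f β') : commutator α β ≤ pullback f (commutator α' β') :=
  commutator_le fun _ hx h => commutator_centralizes α' β' _ (map_mem_termArrays f hα hβ hx) h

theorem le_pullback_top (α : Con T) : α ≤ pullback f ⊤ := fun _ _ _ => trivial

theorem eq_bot_of_le_pullback {f : T →ₙ* S} (hf : Function.Injective f) {α : Con T} {β : Con S}
    (h : α ≤ pullback f β) (hβ : β = ⊥) : α = ⊥ := by
  subst hβ
  exact le_bot_iff.1 fun x y hxy => hf (h hxy)

theorem Solvable.of_injective {f : T →ₙ* S} (hf : Function.Injective f) (h : Solvable S) :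
    Solvable T := by
  have key : ∀ d, derivedCon T d ≤ pullback f (derivedCon S d) := by
    intro d
    induction d with
    | zero => exact le_pullback_top f _
    | succ d ih => exact commutator_le_pullback f ih ih
  exact h.imp fun d hd => eq_bot_of_le_pullback hf (key d) hd

theorem LeftNilpotent.of_injective {f : T →ₙ* S} (hf : Function.Injective f)
    (h : LeftNilpotent S) : LeftNilpotent T := by
  have key : ∀ d, leftSeries T d ≤ pullback f (leftSeries S d) := by
    intro d
    induction d with
    | zero => exact le_pullback_top f _
    | succ d ih => exact commutator_le_pullback f (le_pullback_top f _) ih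
  exact h.imp fun d hd => eq_bot_of_le_pullback hf (key d) hd

theorem RightNilpotent.of_injective {f : T →ₙ* S} (hf : Function.Injective f)
    (h : RightNilpotent S) : RightNilpotent T := by
  have key : ∀ d, rightSeries T d ≤ pullback f (rightSeries S d) := by
    intro d
    induction d with
    | zero => exact le_pullback_top f _
    | succ d ih => exact commutator_le_pullback f ih (le_pullback_top f _)
  exact h.imp fun d hd => eq_bot_of_le_pullback hf (key d) hd

theorem Supernilpotent.of_injective {f : T →ₙ* S} (hf : Function.Injective f)
    (h : Supernilpotent S) : Supernilpotent T := by
  obtain ⟨d, hd⟩ := h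
  refine ⟨d, eq_bot_of_le_pullback (f := f) hf (higherCommutator_le fun x hx h => ?_) hd⟩
  refine higherCommutator_centralizes (fun _ : Fin (d + 1) => (⊤ : Con S)) (fun v => f (x v)) ?_ h
  clear h
  induction hx using Subsemigroup.closure_induction with
  | mem x hx =>
    obtain ⟨i, a, b, -, rfl⟩ := hx
    convert generator_mem_termCubes (α := fun _ : Fin (d + 1) => (⊤ : Con S)) i
      (top_rel (f a) (f b)) using 1
    ext v; exact apply_ite f _ _ _
  | mul x y _ _ hx hy =>
    convert mul_mem hx hy using 1
    ext v; exact f.map_mul _ _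

end Subsemigroup

/-! ### Term condition commutators in groups -/

section Groups

variable {G : Type u} [Group G]

/-- The class of the identity under a congruence of a group. -/
def unitClass (δ : Con G) : Subgroup G where
  carrier := {g | δ g 1}
  one_mem' := δ.refl 1
  mul_mem' := fun {a b} ha hb => by simpa using δ.mul ha hb
  inv_mem' := fun {a} ha => by simpa using δ.symm (δ.mul (δ.refl a⁻¹) ha)

/-- The product of the arrays for `g`, `h`, `g⁻¹`, `h⁻¹`, alternately of row and column type, is `1`
except for `⁅g, h⁆` in the last corner. -/
theorem commutator_unitClass_le (α β : Con G) :
    ⁅unitClass α, unitClass β⁆ ≤ unitClass (commutator α β) := by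
  refine Subgroup.commutator_le.2 fun g hg h hh => ?_
  have hg' : α 1 g := α.symm hg
  have hh' : β 1 h := β.symm hh
  have hg'' : α 1 g⁻¹ := α.symm ((unitClass α).inv_mem hg)
  have hh'' : β 1 h⁻¹ := β.symm ((unitClass β).inv_mem hh)
  have := commutator_centralizes α β _ (mul_mem (mul_mem (mul_mem (row_mem_termArrays hg')
    (col_mem_termArrays hh')) (row_mem_termArrays hg'')) (col_mem_termArrays hh''))
  simp only [Pi.mul_apply, Matrix.cons_val_zero, Matrix.cons_val_one, one_mul, mul_one,
    mul_inv_cancel] at this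
  exact Con.symm _ (this (Con.refl _ _))

theorem unitClass_top : unitClass (⊤ : Con G) = ⊤ := top_le_iff.1 fun _ _ => trivial

theorem eq_bot_of_le_unitClass {N : Subgroup G} {δ : Con G} (h : N ≤ unitClass δ) (hδ : δ = ⊥) :
    N = ⊥ := by
  subst hδ
  exact (Subgroup.eq_bot_iff_forall _).2 fun g hg => h hg

theorem isSolvable_of_solvable (h : Solvable G) : Group.IsSolvable G := by
  have key : ∀ d, derivedSeries G d ≤ unitClass (derivedCon G d) := by
    intro d
    induction d with
    | zero => exact le_of_le_of_eq le_top unitClass_top.symm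
    | succ d ih => exact (Subgroup.commutator_mono ih ih).trans (commutator_unitClass_le _ _)
  obtain ⟨d, hd⟩ := h
  exact ⟨d, eq_bot_of_le_unitClass (key d) hd⟩

theorem isNilpotent_of_leftNilpotent (h : LeftNilpotent G) : Group.IsNilpotent G := by
  have key : ∀ d, (⊤ : Subgroup G).lowerCentralSeries d ≤ unitClass (leftSeries G d) := by
    intro d
    induction d with
    | zero => exact le_of_le_of_eq le_top unitClass_top.symm
    | succ d ih =>
      rw [Subgroup.lowerCentralSeries_succ, Subgroup.commutator_comm]
      exact (Subgroup.commutator_mono unitClass_top.ge ih).trans (commutator_unitClass_le _ _)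
  obtain ⟨d, hd⟩ := h
  exact Subgroup.nilpotent_iff_lowerCentralSeries.2 ⟨d, eq_bot_of_le_unitClass (key d) hd⟩

theorem isNilpotent_of_rightNilpotent (h : RightNilpotent G) : Group.IsNilpotent G := by
  have key : ∀ d, (⊤ : Subgroup G).lowerCentralSeries d ≤ unitClass (rightSeries G d) := by
    intro d
    induction d with
    | zero => exact le_of_le_of_eq le_top unitClass_top.symm
    | succ d ih =>
      rw [Subgroup.lowerCentralSeries_succ]
      exact (Subgroup.commutator_mono ih unitClass_top.ge).trans (commutator_unitClass_le _ _)
  obtain ⟨d, hd⟩ := h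
  exact Subgroup.nilpotent_iff_lowerCentralSeries.2 ⟨d, eq_bot_of_le_unitClass (key d) hd⟩

theorem inv_mem_termCubes {n : ℕ} {x : (Fin (n + 1) → Bool) → G}
    (hx : x ∈ termCubes fun _ : Fin (n + 1) => (⊤ : Con G)) :
    x⁻¹ ∈ termCubes fun _ : Fin (n + 1) => (⊤ : Con G) := by
  induction hx using Subsemigroup.closure_induction with
  | mem x hx =>
    obtain ⟨i, a, b, -, rfl⟩ := hx
    convert generator_mem_termCubes (α := fun _ : Fin (n + 1) => (⊤ : Con G)) i
      (top_rel a⁻¹ b⁻¹) using 1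
    ext v; exact apply_ite _ _ _ _
  | mul x y _ _ hx hy => rw [mul_inv_rev]; exact mul_mem hy hx

open Classical in
/-- The values of those arrays in `M(1, …, 1)` that are constant where the first `k` coordinates
are `1`, and trivial elsewhere. -/
def cornerValues (G : Type u) [Group G] (n k : ℕ) : Subgroup G where
  carrier := {g | (fun v : Fin (n + 1) → Bool => if ∀ i, i.val < k → v i = true then g else 1) ∈
    termCubes fun _ : Fin (n + 1) => (⊤ : Con G)}
  one_mem' := by
    rw [Set.mem_ofPred_eq]
    convert generator_mem_termCubes (α := fun _ : Fin (n + 1) => (⊤ : Con G)) 0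
      (top_rel 1 1) using 1
    ext v; simp
  mul_mem' := fun {a b} ha hb => by
    rw [Set.mem_ofPred_eq] at ha hb ⊢
    convert mul_mem ha hb using 1
    ext v; simp only [Pi.mul_apply]; split_ifs <;> simp
  inv_mem' := fun {a} ha => by
    rw [Set.mem_ofPred_eq] at ha ⊢
    convert inv_mem_termCubes ha using 1
    ext v; simp only [Pi.inv_apply]; split_ifs <;> simp

/-- The pointwise commutator of a function supported on a face with a generator in a new coordinate
is supported on the smaller face where this coordinate is `1` as well. -/
theorem lowerCentralSeries_le_cornerValues {n k : ℕ} (hk : k ≤ n) :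
    (⊤ : Subgroup G).lowerCentralSeries k ≤ cornerValues G n (k + 1) := by
  have gen : ∀ (i : Fin (n + 1)) (g : G), (fun v : Fin (n + 1) → Bool => if v i then g else 1) ∈
      termCubes fun _ : Fin (n + 1) => (⊤ : Con G) :=
    fun i g => generator_mem_termCubes (α := fun _ : Fin (n + 1) => (⊤ : Con G)) i (top_rel 1 g)
  induction k with
  | zero =>
    intro g _
    change _ ∈ termCubes _
    convert gen 0 g using 3 with v
    refine ⟨fun h => h 0 (by simp), fun h i hi => ?_⟩
    rwa [show i = 0 from Fin.ext (by simpa using hi)]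
  | succ k ih =>
    rw [Subgroup.lowerCentralSeries_succ]
    refine Subgroup.commutator_le.2 fun g hg h _ => ?_
    have hg' : _ ∈ termCubes _ := ih (by omega) hg
    have hh := gen ⟨k + 1, by omega⟩ h
    change _ ∈ termCubes _
    convert mul_mem (mul_mem (mul_mem hg' hh) (inv_mem_termCubes hg')) (inv_mem_termCubes hh)
      using 1
    ext v
    have e : (∀ i : Fin (n + 1), i.val < k + 1 + 1 → v i = true) ↔
        (∀ i : Fin (n + 1), i.val < k + 1 → v i = true) ∧ v ⟨k + 1, by omega⟩ = true := by
      refine ⟨fun h => ⟨fun i hi => h i (by omega), h _ (by simp)⟩, fun h i hi => ?_⟩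
      by_cases hik : i.val < k + 1
      · exact h.1 i hik
      · rw [show i = ⟨k + 1, by omega⟩ from Fin.ext (by simp; omega)]; exact h.2
    simp only [Pi.mul_apply, Pi.inv_apply, e]
    by_cases h1 : ∀ i : Fin (n + 1), i.val < k + 1 → v i = true
    · by_cases h2 : v ⟨k + 1, by omega⟩ = true
      · rw [if_pos ⟨h1, h2⟩, if_pos h1, if_pos h2, commutatorElement_def]
      · rw [if_neg fun h => h2 h.2, if_pos h1, if_neg h2]; simp
    · rw [if_neg fun h => h1 h.1, if_neg h1]; simp

theorem isNilpotent_of_supernilpotent (h : Supernilpotent G) : Group.IsNilpotent G := by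
  obtain ⟨d, hd⟩ := h
  refine Subgroup.nilpotent_iff_lowerCentralSeries.2
    ⟨d, (Subgroup.eq_bot_iff_forall _).2 fun g hg => ?_⟩
  have hg' : _ ∈ termCubes _ := lowerCentralSeries_le_cornerValues le_rfl hg
  have := higherCommutator_centralizes _ _ hg'
  rw [hd] at this
  have hf : ∀ r : Fin d → Bool, ¬ ∀ i : Fin (d + 1), i.val < d + 1 →
      (Fin.snoc r false : Fin (d + 1) → Bool) i = true := fun r h => by
    simpa using h (Fin.last d) (by simp)
  have ht : ∀ r : Fin d → Bool, (∀ i : Fin (d + 1), i.val < d + 1 →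
      (Fin.snoc r true : Fin (d + 1) → Bool) i = true) ↔ r = fun _ => true := fun r => by
    simp [Fin.forall_fin_succ', funext_iff]
  simp only [hf, ht, if_false, if_true, bot_rel] at this
  exact (this fun r hr => by rw [if_neg hr]).symm

end Groups

/-! ### Rees coordinates on the kernel -/

section Kernel

variable {S : Type u} [Semigroup S]

/-- `K = SeS` for an idempotent `e` such that `eSe` is a group. -/
structure IsGroupKernel (e : S) (K : Set S) : Prop where
  idem : e * e = e
  eq_setOf : K = {z | ∃ s t : S, z = s * e * t}
  exists_right_inv : ∀ x : S, ∃ y : S, e * y = y ∧ y * e = y ∧ e * x * e * y = e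

namespace IsGroupKernel

variable {e : S} {K : Set S} (h : IsGroupKernel e K)

/-- The group `eSe`. -/
def Corner (_ : IsGroupKernel e K) : Type u := {x : S // e * x = x ∧ x * e = x}

/-- The map `s ↦ ese`. -/
def proj (s : S) : h.Corner :=
  ⟨e * s * e, by rw [← mul_assoc, ← mul_assoc, h.idem], by rw [mul_assoc, h.idem]⟩

noncomputable instance : Group h.Corner :=
  @Group.ofRightAxioms h.Corner
    ⟨fun x y => ⟨x.1 * y.1, by rw [← mul_assoc, x.2.1], by rw [mul_assoc, y.2.2]⟩⟩
    ⟨fun x => ⟨(h.exists_right_inv x.1).choose, (h.exists_right_inv x.1).choose_spec.1,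
      (h.exists_right_inv x.1).choose_spec.2.1⟩⟩
    ⟨⟨e, h.idem, h.idem⟩⟩
    (fun _ _ _ => Subtype.ext (mul_assoc _ _ _))
    (fun x => Subtype.ext x.2.2)
    (fun x => Subtype.ext (by
      have h1 := (h.exists_right_inv x.1).choose_spec.2.2
      have h2 : e * x.1 * e = x.1 := by rw [x.2.1, x.2.2]
      exact (congrArg (· * _) h2.symm).trans h1))

/-- The inverse of `ese` in the group `eSe`. -/
noncomputable def inv (s : S) : S := ((h.proj s)⁻¹).1

theorem coe_mul (x y : h.Corner) : (x * y).1 = x.1 * y.1 := rfl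

theorem coe_one : (1 : h.Corner).1 = e := rfl

theorem coe_proj (s : S) : (h.proj s).1 = e * s * e := rfl

theorem proj_eq_of_eq {s t : S} (hst : e * s * e = e * t * e) : h.proj s = h.proj t :=
  Subtype.ext hst

theorem e_mul_inv (s : S) : e * h.inv s = h.inv s := ((h.proj s)⁻¹).2.1

theorem inv_mul_e (s : S) : h.inv s * e = h.inv s := ((h.proj s)⁻¹).2.2

theorem inv_mul (s : S) : h.inv s * s * e = e := by
  have : h.inv s * (e * s * e) = e := congrArg Subtype.val (inv_mul_cancel (h.proj s))
  rwa [← mul_assoc, ← mul_assoc, h.inv_mul_e] at this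

theorem mul_inv (s : S) : e * s * h.inv s = e := by
  have : e * s * e * h.inv s = e := congrArg Subtype.val (mul_inv_cancel (h.proj s))
  rwa [mul_assoc, h.e_mul_inv] at this

theorem mem_iff (h : IsGroupKernel e K) {z : S} : z ∈ K ↔ ∃ s t : S, z = s * e * t := by
  rw [h.eq_setOf]; rfl

theorem mul_mem_left (h : IsGroupKernel e K) (s : S) {z : S} (hz : z ∈ K) : s * z ∈ K := by
  obtain ⟨a, b, rfl⟩ := h.mem_iff.1 hz
  exact h.mem_iff.2 ⟨s * a, b, by simp only [mul_assoc]⟩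

theorem mul_mem_right (h : IsGroupKernel e K) (s : S) {z : S} (hz : z ∈ K) : z * s ∈ K := by
  obtain ⟨a, b, rfl⟩ := h.mem_iff.1 hz
  exact h.mem_iff.2 ⟨a, b * s, by simp only [mul_assoc]⟩

theorem e_mem (h : IsGroupKernel e K) : e ∈ K := h.mem_iff.2 ⟨e, e, by rw [h.idem, h.idem]⟩

theorem inv_mem (s : S) : h.inv s ∈ K := by
  rw [← h.e_mul_inv]; exact h.mul_mem_right _ h.e_mem

theorem isIdeal (h : IsGroupKernel e K) : IsIdeal K :=
  ⟨⟨e, h.e_mem⟩, fun s _ ha => ⟨h.mul_mem_left s ha, h.mul_mem_right s ha⟩⟩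

/-- For `z = s * e * t` the group element of `z` factors as that of `s` times that of `t`, so its
inverse cancels between `t` and `s`. -/
theorem mul_inv_mul {z : S} (hz : z ∈ K) : z * h.inv z * z = z := by
  obtain ⟨s, t, rfl⟩ := h.mem_iff.1 hz
  have hp : h.proj (s * e * t) = h.proj s * h.proj t := by
    apply Subtype.ext
    rw [h.coe_mul, h.coe_proj, h.coe_proj, h.coe_proj]
    calc e * (s * e * t) * e = e * s * e * t * e := by simp only [mul_assoc]
      _ = e * s * (e * e) * t * e := by rw [h.idem]
      _ = _ := by simp only [mul_assoc]
  have h1 : h.proj t * (h.proj (s * e * t))⁻¹ * h.proj s = 1 := by rw [hp]; group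
  have h2 : e * t * e * h.inv (s * e * t) * (e * s * e) = e := congrArg Subtype.val h1
  calc s * e * t * h.inv (s * e * t) * (s * e * t)
      = s * (e * t * (e * h.inv (s * e * t) * e) * s * e) * t := by
        rw [h.e_mul_inv, h.inv_mul_e]; simp only [mul_assoc]
    _ = s * (e * t * e * h.inv (s * e * t) * (e * s * e)) * t := by simp only [mul_assoc]
    _ = s * e * t := by rw [h2]

/-- The idempotent in `Se` with the same left divisors as `x ∈ K`; it represents the `R`-class of
`x`. -/
noncomputable def rho (x : S) : S := x * h.inv x

/-- The idempotent in `eS` that represents the `L`-class of `x ∈ K`. -/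
noncomputable def lam (x : S) : S := h.inv x * x

theorem rho_def (x : S) : h.rho x = x * h.inv x := rfl

theorem lam_def (x : S) : h.lam x = h.inv x * x := rfl

theorem rho_mul_e (x : S) : h.rho x * e = h.rho x := by rw [rho_def, mul_assoc, h.inv_mul_e]

theorem e_mul_lam (x : S) : e * h.lam x = h.lam x := by rw [lam_def, ← mul_assoc, h.e_mul_inv]

theorem e_mul_rho (x : S) : e * h.rho x = e := by rw [rho_def, ← mul_assoc, h.mul_inv]

theorem lam_mul_e (x : S) : h.lam x * e = e := h.inv_mul x

theorem lam_mem (x : S) : h.lam x ∈ K := h.mul_mem_right _ (h.inv_mem x)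

variable {x y : S}

theorem rho_mul_self (hx : x ∈ K) : h.rho x * x = x := h.mul_inv_mul hx

theorem self_mul_lam (hx : x ∈ K) : x * h.lam x = x := by
  rw [lam_def, ← mul_assoc, h.mul_inv_mul hx]

/-- Since `h.rho x` ends in `e`, the factor `e * (x * s) * h.inv (x * s) = e` is absorbed. Hence the
left coordinate of a product is fixed by any prefix that lies in `K`. -/
theorem rho_mul (hx : x ∈ K) (s : S) : h.rho (x * s) = h.rho x := by
  have h1 := h.mul_inv (x * s)
  calc h.rho (x * s) = h.rho x * x * s * h.inv (x * s) := by
        rw [h.rho_mul_self hx, ← rho_def]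
    _ = h.rho x * e * x * s * h.inv (x * s) := by rw [h.rho_mul_e]
    _ = h.rho x * (e * (x * s) * h.inv (x * s)) := by simp only [mul_assoc]
    _ = h.rho x := by rw [h1, h.rho_mul_e]

theorem lam_mul (hx : x ∈ K) (s : S) : h.lam (s * x) = h.lam x := by
  have h1 := h.inv_mul (s * x)
  calc h.lam (s * x) = h.inv (s * x) * (s * (x * h.lam x)) := by
        rw [h.self_mul_lam hx, ← lam_def]
    _ = h.inv (s * x) * (s * (x * (e * h.lam x))) := by rw [h.e_mul_lam]
    _ = h.inv (s * x) * (s * x) * e * h.lam x := by simp only [mul_assoc]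
    _ = h.lam x := by rw [h1, h.e_mul_lam]

theorem rho_mul_rho (hx : x ∈ K) (s : S) : h.rho (s * h.rho x) = h.rho (s * x) := by
  rw [rho_def h x, ← mul_assoc, h.rho_mul (h.mul_mem_left s hx)]

theorem lam_lam_mul (hx : x ∈ K) (s : S) : h.lam (h.lam x * s) = h.lam (x * s) := by
  rw [lam_def h x, mul_assoc, h.lam_mul (h.mul_mem_right s hx)]

theorem rho_congr (hx : x ∈ K) (hy : y ∈ K) (hxy : h.rho x = h.rho y) (s : S) :
    h.rho (s * x) = h.rho (s * y) := by
  rw [← h.rho_mul_rho hx, ← h.rho_mul_rho hy, hxy]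

theorem lam_congr (hx : x ∈ K) (hy : y ∈ K) (hxy : h.lam x = h.lam y) (s : S) :
    h.lam (x * s) = h.lam (y * s) := by
  rw [← h.lam_lam_mul hx, ← h.lam_lam_mul hy, hxy]

theorem eq_rho_mul_proj_mul_lam (hx : x ∈ K) : x = h.rho x * (h.proj x).1 * h.lam x := by
  calc x = h.rho x * x * h.lam x := by rw [h.rho_mul_self hx, h.self_mul_lam hx]
    _ = h.rho x * e * x * (e * h.lam x) := by rw [h.rho_mul_e, h.e_mul_lam]
    _ = _ := by rw [coe_proj]; simp only [mul_assoc]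

theorem ext (hx : x ∈ K) (hy : y ∈ K) (hr : h.rho x = h.rho y) (hl : h.lam x = h.lam y)
    (hp : h.proj x = h.proj y) : x = y := by
  rw [h.eq_rho_mul_proj_mul_lam hx, h.eq_rho_mul_proj_mul_lam hy, hr, hl, hp]

theorem proj_mul_mul (hy : y ∈ K) (u w : S) :
    h.proj (u * y * w) = h.proj (u * h.rho y) * h.proj y * h.proj (h.lam y * w) := by
  apply Subtype.ext
  rw [h.coe_mul, h.coe_mul, coe_proj, coe_proj, coe_proj, coe_proj]
  calc e * (u * y * w) * e = e * u * (h.rho y * y * h.lam y) * w * e := by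
        rw [h.rho_mul_self hy, h.self_mul_lam hy]; simp only [mul_assoc]
    _ = e * u * (h.rho y * (e * e) * y * ((e * e) * h.lam y)) * w * e := by
        rw [h.idem, h.rho_mul_e, h.e_mul_lam]
    _ = _ := by simp only [mul_assoc]

theorem proj_mul_left (hy : y ∈ K) (u : S) :
    h.proj (u * y) = h.proj (u * h.rho y) * h.proj y := by
  have h1 := h.proj_mul_mul hy u e
  have h2 : h.proj (u * y * e) = h.proj (u * y) :=
    h.proj_eq_of_eq (by rw [mul_assoc, mul_assoc _ e e, h.idem, ← mul_assoc])
  have h3 : h.proj (h.lam y * e) = 1 :=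
    Subtype.ext (by rw [coe_proj, h.lam_mul_e, h.idem, h.idem, coe_one])
  rwa [h2, h3, mul_one] at h1

theorem proj_mul_right (hy : y ∈ K) (w : S) :
    h.proj (y * w) = h.proj y * h.proj (h.lam y * w) := by
  have h1 := h.proj_mul_mul hy e w
  have h2 : h.proj (e * y * w) = h.proj (y * w) :=
    h.proj_eq_of_eq (by rw [mul_assoc e y w, ← mul_assoc e e, h.idem])
  have h3 : h.proj (e * h.rho y) = 1 :=
    Subtype.ext (by rw [coe_proj, h.e_mul_rho, h.idem, h.idem, coe_one])
  rwa [h2, h3, one_mul] at h1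

/-- Rees matrix multiplication: the middle factor is the sandwich matrix entry, which depends only
on the right coordinate of `x` and the left coordinate of `y`. -/
theorem proj_mul (hx : x ∈ K) (hy : y ∈ K) :
    h.proj (x * y) = h.proj x * h.proj (h.lam x * h.rho y) * h.proj y := by
  rw [h.proj_mul_left hy, h.proj_mul_right hx]

/-- Both inverses have the form `h.inv a * e * _ * h.inv b`, with `b` or `a` in the gap. -/
theorem inv_congr (δ : Con S) {a b : S} (hab : δ a b) : δ (h.inv a) (h.inv b) := by
  have h1 : h.inv a * e * b * h.inv b = h.inv a := by
    rw [mul_assoc _ e, mul_assoc _ (e * b), h.mul_inv, h.inv_mul_e]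
  have h2 : h.inv a * e * a * h.inv b = h.inv b := by
    rw [h.inv_mul_e]
    calc h.inv a * a * h.inv b = h.inv a * a * (e * h.inv b) := by rw [h.e_mul_inv]
      _ = h.inv a * a * e * h.inv b := by simp only [mul_assoc]
      _ = h.inv b := by rw [h.inv_mul, h.e_mul_inv]
  have h3 : δ (h.inv a * e * b * h.inv b) (h.inv a * e * a * h.inv b) :=
    δ.mul (δ.mul (δ.refl _) (δ.symm hab)) (δ.refl _)
  rwa [h1, h2] at h3

/-- The kernel as a subsemigroup. -/
def toSubsemigroup (hk : IsGroupKernel e K) : Subsemigroup S where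
  carrier := K
  mul_mem' := fun {a _} _ hb => hk.mul_mem_left a hb

/-- Both sides have the same outer coordinates and become equal after left multiplication by `z`.
For a fixed left coordinate this multiplies the group coordinate by a constant, which cancels. -/
theorem mul_inv_mul_mul (z : S) {w : S} (hw : w ∈ K) :
    w * h.inv (z * w) * z * w = w := by
  have hw' : w * h.inv (z * w) * z * w ∈ K := h.mul_mem_left _ hw
  have hr : h.rho (w * h.inv (z * w) * z * w) = h.rho w := by
    simp only [mul_assoc]; exact h.rho_mul hw _
  refine h.ext hw' hw hr (h.lam_mul hw _) ?_
  have h1 : z * (w * h.inv (z * w) * z * w) = z * w := by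
    have := h.mul_inv_mul (h.mul_mem_left z hw)
    simpa only [mul_assoc] using this
  have h2 := h.proj_mul_left hw' z
  rw [h1, hr, h.proj_mul_left hw z] at h2
  exact (mul_left_cancel h2).symm

/-- If `α` centralizes `β` modulo `δ`, and `x` and `y` are congruent to elements of the kernel
modulo `α` and `β`, then `xy` is congruent to an element of the kernel modulo `δ`. -/
theorem exists_rel_mul (h : IsGroupKernel e K) {α β δ : Con S} (hC : Centralizes α β δ) {z w : S} (hz : z ∈ K)
    (hxz : α x z) (hw : w ∈ K) (hyw : β y w) : ∃ k ∈ K, δ (x * y) k := by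
  -- This replacement `y'` of `y` satisfies `z * y' = z * y`, so the row of `z` is constant and the
  -- term condition transfers this to the row of `x`.
  have hy' : β y (y * h.inv (z * y) * z * y) := by
    refine β.trans hyw (β.symm ?_)
    have h1 : β (z * y) (z * w) := β.mul (β.refl z) hyw
    have h2 := β.mul (β.mul (β.mul hyw (h.inv_congr β h1)) (β.refl z)) hyw
    rwa [h.mul_inv_mul_mul z hw] at h2
  refine ⟨x * (y * h.inv (z * y) * z * y), ?_, ?_⟩
  · rw [← mul_assoc]
    exact h.mul_mem_right _ (h.mul_mem_left _ (h.mul_mem_left _ hz))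
  · have h1 := hC _ (mul_mem (row_mem_termArrays (β := β) (α.symm hxz))
      (col_mem_termArrays (α := α) hy'))
    simp only [Pi.mul_apply, Matrix.cons_val_zero, Matrix.cons_val_one] at h1
    apply h1
    have := h.mul_inv_mul (h.mul_mem_right y hz)
    simp only [mul_assoc] at this ⊢
    rw [this]; exact δ.refl _

end IsGroupKernel

end Kernel

/-! ### Long products lie in the kernel -/

section Products

variable {S : Type u} [Semigroup S]

theorem exists_mul_of_mem_prodSet {i j : ℕ} {x : S} (hx : x ∈ prodSet S (i + j + 1)) :
    ∃ y ∈ prodSet S i, ∃ z ∈ prodSet S j, x = y * z := by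
  induction j generalizing x with
  | zero =>
    obtain ⟨y, hy, z, rfl⟩ := hx
    exact ⟨y, hy, z, trivial, rfl⟩
  | succ j ih =>
    obtain ⟨y, hy, z, rfl⟩ := hx
    obtain ⟨a, ha, b, hb, rfl⟩ := ih hy
    exact ⟨a, ha, b * z, ⟨b, hb, z, rfl⟩, mul_assoc _ _ _⟩

/-- Every product of `m + 1` elements is `δ`-congruent to an element of `K`. -/
def ProductsNear (K : Set S) (δ : Con S) (m : ℕ) : Prop :=
  ∀ x ∈ prodSet S m, ∃ z ∈ K, δ x z

variable {e : S} {K : Set S}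

theorem productsNear_top (h : IsGroupKernel e K) : ProductsNear K (⊤ : Con S) 0 :=
  fun _ _ => ⟨e, h.e_mem, trivial⟩

theorem ProductsNear.commutator (h : IsGroupKernel e K) {α β : Con S} {i j : ℕ}
    (hα : ProductsNear K α i) (hβ : ProductsNear K β j) :
    ProductsNear K (commutator α β) (i + j + 1) := by
  intro x hx
  obtain ⟨y, hy, z, hz, rfl⟩ := exists_mul_of_mem_prodSet hx
  obtain ⟨a, ha, hya⟩ := hα y hy
  obtain ⟨b, hb, hzb⟩ := hβ z hz
  exact h.exists_rel_mul (commutator_centralizes α β) ha hya hb hzb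

theorem ProductsNear.prodSet_subset {δ : Con S} {m : ℕ} (h : ProductsNear K δ m) (hδ : δ = ⊥) :
    prodSet S m ⊆ K := by
  subst hδ
  intro x hx
  obtain ⟨z, hz, hxz⟩ := h x hx
  exact (bot_rel.1 hxz) ▸ hz

theorem Solvable.exists_prodSet_subset (h : IsGroupKernel e K) (hS : Solvable S) :
    ∃ m, prodSet S m ⊆ K := by
  have key : ∀ d, ∃ m, ProductsNear K (derivedCon S d) m := by
    intro d
    induction d with
    | zero => exact ⟨0, productsNear_top h⟩
    | succ d ih => obtain ⟨m, hm⟩ := ih; exact ⟨_, hm.commutator h hm⟩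
  obtain ⟨d, hd⟩ := hS
  obtain ⟨m, hm⟩ := key d
  exact ⟨m, hm.prodSet_subset hd⟩

theorem LeftNilpotent.exists_prodSet_subset (h : IsGroupKernel e K) (hS : LeftNilpotent S) :
    ∃ m, prodSet S m ⊆ K := by
  have key : ∀ d, ∃ m, ProductsNear K (leftSeries S d) m := by
    intro d
    induction d with
    | zero => exact ⟨0, productsNear_top h⟩
    | succ d ih => obtain ⟨m, hm⟩ := ih; exact ⟨_, (productsNear_top h).commutator h hm⟩
  obtain ⟨d, hd⟩ := hS
  obtain ⟨m, hm⟩ := key d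
  exact ⟨m, hm.prodSet_subset hd⟩

theorem RightNilpotent.exists_prodSet_subset (h : IsGroupKernel e K) (hS : RightNilpotent S) :
    ∃ m, prodSet S m ⊆ K := by
  have key : ∀ d, ∃ m, ProductsNear K (rightSeries S d) m := by
    intro d
    induction d with
    | zero => exact ⟨0, productsNear_top h⟩
    | succ d ih => obtain ⟨m, hm⟩ := ih; exact ⟨_, hm.commutator h (productsNear_top h)⟩
  obtain ⟨d, hd⟩ := hS
  obtain ⟨m, hm⟩ := key d
  exact ⟨m, hm.prodSet_subset hd⟩

/-- For a product `p` of `k + 1` elements there is an array in `M(1, …, 1)` that only depends on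
the first `k + 1` coordinates, is `p` where they all are `1`, and lies in `Sep` elsewhere. -/
theorem exists_termCube_prodSet (h : IsGroupKernel e K) {n k : ℕ} (hk : k ≤ n) {p : S}
    (hp : p ∈ prodSet S k) :
    ∃ x ∈ termCubes fun _ : Fin (n + 1) => (⊤ : Con S),
      (∀ v w, (∀ i : Fin (n + 1), i.val ≤ k → v i = w i) → x v = x w) ∧
      ∀ v, ((∀ i : Fin (n + 1), i.val ≤ k → v i = true) → x v = p) ∧
        ((∃ i : Fin (n + 1), i.val ≤ k ∧ v i = false) → ∃ c, x v = c * (e * p)) := by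
  induction k generalizing p with
  | zero =>
    refine ⟨_, generator_mem_termCubes 0 (top_rel (e * p) p), fun v w hvw => ?_,
      fun v => ⟨fun hv => ?_, ?_⟩⟩
    · simp only [hvw 0 (by simp)]
    · simp only [hv 0 (by simp), if_true]
    · rintro ⟨i, hi, hv⟩
      rw [show i = 0 from Fin.ext (by simpa using hi)] at hv
      refine ⟨e, ?_⟩
      simp only [hv]
      rw [← mul_assoc, h.idem]; rfl
  | succ k ih =>
    obtain ⟨q, hq, z, rfl⟩ := hp
    obtain ⟨x, hx, hdep, hval⟩ := ih (by omega) hq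
    -- The new generator already ends in `e * (q * z)` where its coordinate is `0`; where it is `1`,
    -- a `0` among the earlier coordinates supplies a factor `e * q` in front of `z`.
    refine ⟨_, mul_mem hx (generator_mem_termCubes ⟨k + 1, by omega⟩
      (top_rel (e * (q * z)) z)), fun v w hvw => ?_, fun v => ⟨fun hv => ?_, ?_⟩⟩
    · simp only [Pi.mul_apply]
      rw [hdep v w fun i hi => hvw i (by omega), hvw ⟨k + 1, by omega⟩ le_rfl]
    · simp only [Pi.mul_apply]
      rw [(hval v).1 fun i hi => hv i (by omega), hv ⟨k + 1, by omega⟩ le_rfl, if_pos rfl]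
    · rintro ⟨i, hi, hv⟩
      simp only [Pi.mul_apply]
      by_cases hlast : v ⟨k + 1, by omega⟩ = true
      · have hik : i.val ≤ k := by
          rcases Nat.lt_or_ge k i.val with hik | hik
          · rw [show i = ⟨k + 1, by omega⟩ from Fin.ext (by simp; omega), hlast] at hv
            cases hv
          · exact hik
        obtain ⟨c, hc⟩ := (hval v).2 ⟨i, hik, hv⟩
        rw [hc, if_pos hlast]
        exact ⟨c, by simp only [mul_assoc]⟩
      · rw [if_neg hlast]
        exact ⟨_, rfl⟩

theorem snoc_castSucc_eq {n : ℕ} (r : Fin n → Bool) (b b' : Bool) {i : Fin (n + 1)}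
    (hi : i.val < n) : (Fin.snoc r b : Fin (n + 1) → Bool) i =
      (Fin.snoc r b' : Fin (n + 1) → Bool) i := by
  rw [show i = Fin.castSucc ⟨i.val, hi⟩ from rfl, Fin.snoc_castSucc, Fin.snoc_castSucc]

/-- The last coordinate switches between `h.lam (e * q) * y` and `y`. Off the corner row the
preceding factor is a left multiple of `e * q`, which absorbs `h.lam (e * q)`, so the columns agree.
The term condition gives `q * h.lam (e * q) * y = q * y`, where the left side is in the kernel. -/
theorem Supernilpotent.exists_prodSet_subset (h : IsGroupKernel e K) (hS : Supernilpotent S) :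
    ∃ m, prodSet S m ⊆ K := by
  obtain ⟨n, hn⟩ := hS
  have hC := higherCommutator_centralizes (fun _ : Fin (n + 1) => (⊤ : Con S))
  rw [hn] at hC
  refine ⟨n, fun p hp => ?_⟩
  cases n with
  -- The unary term condition has no premises, so here it forces all elements to be equal.
  | zero =>
    have := hC _ (generator_mem_termCubes 0 (top_rel e p)) fun r hr =>
      absurd (Subsingleton.elim _ _) hr
    simp only [bot_rel] at this
    have h0 : ∀ b, (Fin.snoc (fun _ => true : Fin 0 → Bool) b : Fin 1 → Bool) 0 = b :=
      fun b => Fin.snoc_last (n := 0) (α := fun _ => Bool) b _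
    rw [h0, h0] at this
    simp only [if_true] at this
    rw [← this]
    exact h.e_mem
  | succ n =>
    obtain ⟨q, hq, y, rfl⟩ := hp
    obtain ⟨x, hx, hdep, hval⟩ := exists_termCube_prodSet (n := n + 1) h (Nat.le_succ n) hq
    have hw : e * q ∈ K := h.mul_mem_right q h.e_mem
    have := hC _ (mul_mem hx (generator_mem_termCubes (Fin.last (n + 1))
      (top_rel (h.lam (e * q) * y) y)))
    simp only [bot_rel, Pi.mul_apply, Fin.snoc_last, if_true] at this
    have hdep' : ∀ r : Fin (n + 1) → Bool, x (Fin.snoc r true) = x (Fin.snoc r false) := fun r =>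
      hdep _ _ fun i hi => snoc_castSucc_eq r _ _ (by omega)
    have h1 : x (Fin.snoc (fun _ => true) true) = q := (hval _).1 fun i hi => by
      refine Fin.lastCases ?_ (fun i => ?_) i
      · exact Fin.snoc_last (n := n + 1) (α := fun _ => Bool) true _
      · exact Fin.snoc_castSucc (n := n + 1) (α := fun _ => Bool) true _ i
    have h2 := this fun r hr => by
      obtain ⟨i, hi⟩ := Function.ne_iff.1 hr
      obtain ⟨c, hc⟩ := (hval (Fin.snoc r false)).2 ⟨i.castSucc, Nat.le_of_lt_succ i.isLt, by
        rw [Fin.snoc_castSucc]; simpa using hi⟩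
      rw [hdep' r, hc]
      simp only [Bool.false_eq_true, if_false]
      rw [← mul_assoc, mul_assoc c, h.self_mul_lam hw]
    rw [← hdep', h1] at h2
    simp only [Bool.false_eq_true, if_false] at h2
    rw [← h2]
    exact h.mul_mem_left _ (h.mul_mem_right _ (h.lam_mem _))

end Products

/-! ### Primitive idempotents and the forward implications -/

section Idempotents

variable {S : Type u} [Semigroup S]

/-- All idempotents are primitive. -/
def IdempotentsPrimitive (S : Type u) [Semigroup S] : Prop :=
  ∀ e : S, e * e = e → IsPrimitiveIdempotent e

theorem Centralizes.rel_of_idempotent_le {α β δ : Con S} (hC : Centralizes α β δ) {e f : S}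
    (he : e * e = e) (hf : f * f = f) (hfe : f * e = f) (hef : e * f = f) (hα : α f e)
    (hβ : β f e) : δ f e := by
  have := hC _ (mul_mem (row_mem_termArrays (β := β) hα) (col_mem_termArrays (α := α) hβ))
  simp only [Pi.mul_apply, Matrix.cons_val_zero, Matrix.cons_val_one, he, hf, hfe, hef] at this
  exact this (δ.refl _)

theorem Solvable.idempotentsPrimitive (hS : Solvable S) : IdempotentsPrimitive S := by
  refine fun e he => ⟨he, fun f hf hfe hef => ?_⟩
  have key : ∀ d, derivedCon S d f e := by
    intro d
    induction d with
    | zero => trivial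
    | succ d ih => exact (commutator_centralizes _ _).rel_of_idempotent_le he hf hfe hef ih ih
  obtain ⟨d, hd⟩ := hS
  exact bot_rel.1 (hd ▸ key d)

theorem LeftNilpotent.idempotentsPrimitive (hS : LeftNilpotent S) : IdempotentsPrimitive S := by
  refine fun e he => ⟨he, fun f hf hfe hef => ?_⟩
  have key : ∀ d, leftSeries S d f e := by
    intro d
    induction d with
    | zero => trivial
    | succ d ih =>
      exact (commutator_centralizes _ _).rel_of_idempotent_le he hf hfe hef trivial ih
  obtain ⟨d, hd⟩ := hS
  exact bot_rel.1 (hd ▸ key d)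

theorem RightNilpotent.idempotentsPrimitive (hS : RightNilpotent S) : IdempotentsPrimitive S := by
  refine fun e he => ⟨he, fun f hf hfe hef => ?_⟩
  have key : ∀ d, rightSeries S d f e := by
    intro d
    induction d with
    | zero => trivial
    | succ d ih =>
      exact (commutator_centralizes _ _).rel_of_idempotent_le he hf hfe hef ih trivial
  obtain ⟨d, hd⟩ := hS
  exact bot_rel.1 (hd ▸ key d)

open Classical in
-- Multiply the generators for `(f, e)` over the first `k + 1` coordinates; a single factor `f`
-- turns the product into `f`.
theorem indicator_mem_termCubes {n k : ℕ} (hk : k ≤ n) {e f : S} (he : e * e = e)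
    (hf : f * f = f) (hfe : f * e = f) (hef : e * f = f) :
    (fun v : Fin (n + 1) → Bool => if ∀ i : Fin (n + 1), i.val ≤ k → v i = true then e else f) ∈
      termCubes fun _ : Fin (n + 1) => (⊤ : Con S) := by
  induction k with
  | zero =>
    convert generator_mem_termCubes (α := fun _ : Fin (n + 1) => (⊤ : Con S)) 0 (top_rel f e)
      using 3 with v
    refine ⟨fun h => h 0 (by simp), fun h i hi => ?_⟩
    rwa [show i = 0 from Fin.ext (by simpa using hi)]
  | succ k ih =>
    convert mul_mem (ih (by omega)) (generator_mem_termCubes ⟨k + 1, by omega⟩ (top_rel f e))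
      using 1
    ext v
    simp only [Pi.mul_apply]
    have e : (∀ i : Fin (n + 1), i.val ≤ k + 1 → v i = true) ↔
        (∀ i : Fin (n + 1), i.val ≤ k → v i = true) ∧ v ⟨k + 1, by omega⟩ = true := by
      refine ⟨fun h => ⟨fun i hi => h i (by omega), h _ le_rfl⟩, fun h i hi => ?_⟩
      by_cases hik : i.val ≤ k
      · exact h.1 i hik
      · rw [show i = ⟨k + 1, by omega⟩ from Fin.ext (by simp; omega)]; exact h.2
    by_cases h1 : ∀ i : Fin (n + 1), i.val ≤ k → v i = true
    · by_cases h2 : v ⟨k + 1, by omega⟩ = true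
      · rw [if_pos (e.2 ⟨h1, h2⟩), if_pos h1, if_pos h2, he]
      · rw [if_neg fun h => h2 (e.1 h).2, if_pos h1, if_neg h2, hef]
    · rw [if_neg fun h => h1 (e.1 h).1, if_neg h1]
      split_ifs <;> simp only [hf, hfe]

theorem Supernilpotent.idempotentsPrimitive (hS : Supernilpotent S) : IdempotentsPrimitive S := by
  refine fun e he => ⟨he, fun f hf hfe hef => ?_⟩
  obtain ⟨n, hn⟩ := hS
  have := higherCommutator_centralizes _ _
    (indicator_mem_termCubes (n := n) le_rfl he hf hfe hef)
  rw [hn] at this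
  have hlast : ∀ r : Fin n → Bool, ¬ ∀ i : Fin (n + 1), i.val ≤ n →
      (Fin.snoc r false : Fin (n + 1) → Bool) i = true := fun r h => by
    simpa using h (Fin.last n) (by simp)
  have htrue : ∀ r : Fin n → Bool, (∀ i : Fin (n + 1), i.val ≤ n →
      (Fin.snoc r true : Fin (n + 1) → Bool) i = true) ↔ r = fun _ => true := fun r => by
    have : ∀ i : Fin n, i.val ≤ n := fun i => i.isLt.le
    simp [Fin.forall_fin_succ', funext_iff, this]
  simp only [hlast, htrue, if_false, if_true, bot_rel] at this
  exact this fun r hr => by rw [if_neg hr]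

theorem powSucc_succ' (a : S) (n : ℕ) : powSucc a (n + 1) = a * powSucc a n := by
  induction n with
  | zero => rfl
  | succ n ih =>
    calc powSucc a (n + 1) * a = a * powSucc a n * a := by rw [ih]
      _ = a * powSucc a (n + 1) := mul_assoc _ _ _

/-- With `a = e * x * e` and `p` a regular power of `a`, say `p * b * p = p`, the idempotent `p * b
* e` lies below `e`, so it equals `e`. Splitting off the first factor `a` of `p` gives the right
inverse. -/
theorem exists_right_inv_of_eventuallyRegular (hS : EventuallyRegular S)
    (hI : IdempotentsPrimitive S) {e : S} (he : e * e = e) (x : S) :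
    ∃ y : S, e * y = y ∧ y * e = y ∧ e * x * e * y = e := by
  set a := e * x * e with ha
  have hea : e * a = a := by rw [ha, ← mul_assoc, ← mul_assoc, he]
  have hae : a * e = a := by rw [ha, mul_assoc, he]
  obtain ⟨n, b, hb⟩ := hS a
  have hpe : ∀ n, powSucc a n * e = powSucc a n := by
    intro n
    cases n with
    | zero => exact hae
    | succ n => rw [powSucc, mul_assoc, hae]
  have hep : ∀ n, e * powSucc a n = powSucc a n := by
    intro n
    cases n with
    | zero => exact hea
    | succ n => rw [powSucc_succ', ← mul_assoc, hea]
  -- If the regular power is `a` itself, the remaining factor is `e`.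
  obtain ⟨q, hq, hpq⟩ : ∃ q, e * q = q ∧ powSucc a n = a * q := by
    cases n with
    | zero => exact ⟨e, he, hae.symm⟩
    | succ n => exact ⟨powSucc a n, hep n, powSucc_succ' a n⟩
  have hfe : powSucc a n * b * e * e = powSucc a n * b * e := by rw [mul_assoc, he]
  have hef : e * (powSucc a n * b * e) = powSucc a n * b * e := by
    rw [← mul_assoc, ← mul_assoc, hep]
  have hff : powSucc a n * b * e * (powSucc a n * b * e) = powSucc a n * b * e := by
    calc _ = powSucc a n * b * (e * powSucc a n) * b * e := by simp only [mul_assoc]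
      _ = _ := by rw [hep, hb]
  have := (hI e he).2 _ hff hfe hef
  refine ⟨q * b * e, by rw [← mul_assoc, ← mul_assoc, hq], by rw [mul_assoc, he], ?_⟩
  rw [← mul_assoc, ← mul_assoc, ← hpq, this]

theorem exists_isGroupKernel [Nonempty S] (hS : EventuallyRegular S)
    (hI : IdempotentsPrimitive S) : ∃ (e : S) (K : Set S), IsGroupKernel e K := by
  obtain ⟨a⟩ := ‹Nonempty S›
  obtain ⟨n, b, hb⟩ := hS a
  have he : powSucc a n * b * (powSucc a n * b) = powSucc a n * b := by rw [← mul_assoc, hb]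
  exact ⟨_, _, he, rfl, exists_right_inv_of_eventuallyRegular hS hI he⟩

/-- An ideal containing `a` contains every `s * e * t`, because `e = h.inv a * a * e`. -/
theorem IsGroupKernel.completelySimple {e : S} {K : Set S} (h : IsGroupKernel e K)
    (hI : IdempotentsPrimitive S) : CompletelySimple h.toSubsemigroup := by
  refine ⟨fun I hI => Set.eq_univ_of_forall fun z => ?_, ⟨e, h.e_mem⟩, Subtype.ext h.idem,
    fun f hf hfe hef => ?_⟩
  · obtain ⟨⟨a, ha⟩, hideal⟩ := hI
    obtain ⟨s, t, hz⟩ := h.mem_iff.1 z.2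
    have h1 := (hideal ⟨s * h.inv a, h.mul_mem_left _ (h.inv_mem _)⟩ _ ha).1
    have h2 := (hideal ⟨e * t, h.mul_mem_right _ h.e_mem⟩ _ h1).2
    convert h2
    apply Subtype.ext
    rw [hz]
    calc s * e * t = s * (h.inv a * a * e) * t := by rw [h.inv_mul]
      _ = s * h.inv a * a * (e * t) := by simp only [mul_assoc]
  · exact Subtype.ext ((hI e h.idem).2 f.1 (congrArg Subtype.val hf) (congrArg Subtype.val hfe)
      (congrArg Subtype.val hef))

theorem exists_nilpotentExtension [Nonempty S] (hS : EventuallyRegular S)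
    (hI : IdempotentsPrimitive S)
    (hP : ∀ (e : S) (K : Set S), IsGroupKernel e K → ∃ m, prodSet S m ⊆ K) :
    ∃ K : Subsemigroup S, IsNilpotentExtensionOf S K ∧ CompletelySimple K := by
  obtain ⟨e, K, h⟩ := exists_isGroupKernel hS hI
  exact ⟨h.toSubsemigroup, ⟨h.isIdeal, hP e K h⟩, h.completelySimple hI⟩

theorem exists_subsemigroup_of_solvable [Nonempty S] (hS : EventuallyRegular S)
    (h : Solvable S) : ∃ K : Subsemigroup S, IsNilpotentExtensionOf S K ∧
      CompletelySimple K ∧ SubgroupsSolvable K := by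
  obtain ⟨K, hK, hK'⟩ := exists_nilpotentExtension hS h.idempotentsPrimitive
    fun _ _ hk => h.exists_prodSet_subset hk
  exact ⟨K, hK, hK', fun G _ f hf => isSolvable_of_solvable
    (h.of_injective (f := (MulMemClass.subtype K).comp f) (Subtype.val_injective.comp hf))⟩

theorem exists_subsemigroup_of_leftNilpotent [Nonempty S] (hS : EventuallyRegular S)
    (h : LeftNilpotent S) : ∃ K : Subsemigroup S, IsNilpotentExtensionOf S K ∧
      CompletelySimple K ∧ SubgroupsNilpotent K := by
  obtain ⟨K, hK, hK'⟩ := exists_nilpotentExtension hS h.idempotentsPrimitive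
    fun _ _ hk => h.exists_prodSet_subset hk
  exact ⟨K, hK, hK', fun G _ f hf => isNilpotent_of_leftNilpotent
    (h.of_injective (f := (MulMemClass.subtype K).comp f) (Subtype.val_injective.comp hf))⟩

theorem exists_subsemigroup_of_rightNilpotent [Nonempty S] (hS : EventuallyRegular S)
    (h : RightNilpotent S) : ∃ K : Subsemigroup S, IsNilpotentExtensionOf S K ∧
      CompletelySimple K ∧ SubgroupsNilpotent K := by
  obtain ⟨K, hK, hK'⟩ := exists_nilpotentExtension hS h.idempotentsPrimitive
    fun _ _ hk => h.exists_prodSet_subset hk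
  exact ⟨K, hK, hK', fun G _ f hf => isNilpotent_of_rightNilpotent
    (h.of_injective (f := (MulMemClass.subtype K).comp f) (Subtype.val_injective.comp hf))⟩

theorem exists_subsemigroup_of_supernilpotent [Nonempty S] (hS : EventuallyRegular S)
    (h : Supernilpotent S) : ∃ K : Subsemigroup S, IsNilpotentExtensionOf S K ∧
      CompletelySimple K ∧ SubgroupsNilpotent K := by
  obtain ⟨K, hK, hK'⟩ := exists_nilpotentExtension hS h.idempotentsPrimitive
    fun _ _ hk => h.exists_prodSet_subset hk
  exact ⟨K, hK, hK', fun G _ f hf => isNilpotent_of_supernilpotent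
    (h.of_injective (f := (MulMemClass.subtype K).comp f) (Subtype.val_injective.comp hf))⟩

end Idempotents

/-! ### Completely simple ideals have a corner group -/

section Kernel

variable {S : Type u} [Semigroup S]

theorem exists_isGroupKernel_of_completelySimple {K : Subsemigroup S}
    (hid : IsIdeal (K : Set S)) (hK : CompletelySimple K) :
    ∃ e : S, IsGroupKernel e (K : Set S) := by
  obtain ⟨hsimple, e, he, hprim⟩ := hK
  have hfac : ∀ a z : K, ∃ s t : K, z = s * a * t := by
    intro a z
    have hI : IsIdeal {z : K | ∃ s t : K, z = s * a * t} := by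
      refine ⟨⟨a * a * a, a, a, rfl⟩, ?_⟩
      rintro u _ ⟨s, t, rfl⟩
      exact ⟨⟨u * s, t, by simp only [mul_assoc]⟩, ⟨s, t * u, by simp only [mul_assoc]⟩⟩
    have : z ∈ {z : K | ∃ s t : K, z = s * a * t} := by rw [hsimple _ hI]; trivial
    exact this
  have heK : e.1 * e.1 = e.1 := congrArg Subtype.val he
  refine ⟨e, heK, Set.ext fun z => ⟨fun hz => ?_, ?_⟩, fun x => ?_⟩
  · obtain ⟨s, t, hst⟩ := hfac e ⟨z, hz⟩
    exact ⟨s, t, congrArg Subtype.val hst⟩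
  · rintro ⟨s, t, rfl⟩
    exact (hid.2 t _ (hid.2 s _ e.2).1).2
  · set a : K := ⟨e.1 * x * e.1, (hid.2 e.1 _ (hid.2 x _ e.2).2).2⟩
    have hea : e * a = a := Subtype.ext (by
      change e.1 * (e.1 * x * e.1) = e.1 * x * e.1
      rw [← mul_assoc, ← mul_assoc, heK])
    have hae : a * e = a := Subtype.ext (by
      change e.1 * x * e.1 * e.1 = e.1 * x * e.1
      rw [mul_assoc, heK])
    obtain ⟨s, t, hst⟩ := hfac a e
    have hpaq : e * s * e * a * (e * t * e) = e := by
      calc e * s * e * a * (e * t * e) = e * (s * (e * a * e) * t) * e := by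
            simp only [mul_assoc]
        _ = e := by rw [hea, hae, ← hst, he, he]
    -- If `p * a * q = e` in the corner, then `a * q * p` is an idempotent below `e`. Primitivity
    -- makes it `e`, and `q * p` is the right inverse.
    have hf : a * (e * t * e) * (e * s * e) * (a * (e * t * e) * (e * s * e)) =
        a * (e * t * e) * (e * s * e) := by
      calc _ = a * (e * t * e) * (e * s * e * a * (e * t * e)) * (e * s * e) := by
            simp only [mul_assoc]
        _ = a * (e * t * (e * e)) * (e * s * e) := by rw [hpaq]; simp only [mul_assoc]
        _ = _ := by rw [he]
    have hfe : a * (e * t * e) * (e * s * e) * e = a * (e * t * e) * (e * s * e) := by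
      simp only [mul_assoc, he]
    have hef : e * (a * (e * t * e) * (e * s * e)) = a * (e * t * e) * (e * s * e) := by
      simp only [← mul_assoc, hea]
    have h1 := hprim _ hf hfe hef
    refine ⟨(e * t * e * (e * s * e) : K).1, ?_, ?_, ?_⟩
    · exact congrArg Subtype.val (show e * (e * t * e * (e * s * e)) = e * t * e * (e * s * e) by
        simp only [← mul_assoc, he])
    · exact congrArg Subtype.val (show e * t * e * (e * s * e) * e = e * t * e * (e * s * e) by
        simp only [mul_assoc, he])
    · exact congrArg Subtype.val (show a * (e * t * e * (e * s * e)) = e by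
        rw [← mul_assoc, h1])

/-- The embedding of the group `eSe` into the kernel. -/
def cornerHom {e : S} {K : Subsemigroup S} (h : IsGroupKernel e (K : Set S)) :
    h.Corner →ₙ* K where
  toFun x := ⟨x.1, by
    have := h.mul_mem_right x.1 h.e_mem
    rwa [x.2.1] at this⟩
  map_mul' _ _ := rfl

theorem cornerHom_injective {e : S} {K : Subsemigroup S} (h : IsGroupKernel e (K : Set S)) :
    Function.Injective (cornerHom h) :=
  fun _ _ hxy => Subtype.ext (congrArg (fun z : K => z.1) hxy)

end Kernel

/-- Applied separately to `rhoRel` and `lamRel`, whose classes in one array may be constant in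
different directions. -/
theorem rows_cols_implications {X : Type u} {E : X → X → Prop} (hE : Equivalence E) {x : Fin 2 → Fin 2 → X}
    (hx : (∀ j, E (x 0 j) (x 1 j)) ∨ ∀ i, E (x i 0) (x i 1)) :
    (E (x 0 0) (x 0 1) → E (x 1 0) (x 1 1)) ∧ (E (x 0 0) (x 1 0) → E (x 0 1) (x 1 1)) := by
  rcases hx with hx | hx
  · exact ⟨fun hh => hE.trans (hE.symm (hx 0)) (hE.trans hh (hx 1)), fun _ => hx 1⟩
  · exact ⟨fun _ => hx 1, fun hh => hE.trans (hE.symm (hx 0)) (hE.trans hh (hx 1))⟩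

/-! ### Chains of congruences from `1` down to `0` -/

section Congruences

variable {S : Type u} [Semigroup S]

/-- The congruence that is `Q` on an ideal and equality elsewhere. -/
def idealCon (I : Set S) (hI : ∀ s, ∀ a ∈ I, s * a ∈ I ∧ a * s ∈ I) (Q : S → S → Prop)
    (hQ : Equivalence Q)
    (left : ∀ s, ∀ x ∈ I, ∀ y ∈ I, Q x y → Q (s * x) (s * y))
    (right : ∀ s, ∀ x ∈ I, ∀ y ∈ I, Q x y → Q (x * s) (y * s)) : Con S where
  r x y := x = y ∨ x ∈ I ∧ y ∈ I ∧ Q x y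
  iseqv :=
    { refl := fun _ => Or.inl rfl
      symm := by
        rintro x y (rfl | ⟨hx, hy, h⟩)
        · exact Or.inl rfl
        · exact Or.inr ⟨hy, hx, hQ.symm h⟩
      trans := by
        rintro x y z (rfl | ⟨hx, hy, h⟩) (rfl | ⟨hy', hz, h'⟩)
        · exact Or.inl rfl
        · exact Or.inr ⟨hy', hz, h'⟩
        · exact Or.inr ⟨hx, hy, h⟩
        · exact Or.inr ⟨hx, hz, hQ.trans h h'⟩ }
  mul' := by
    rintro w x y z (rfl | ⟨hw, hx, h⟩) (rfl | ⟨hy, hz, h'⟩)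
    · exact Or.inl rfl
    · exact Or.inr ⟨(hI _ _ hy).1, (hI _ _ hz).1, left _ _ hy _ hz h'⟩
    · exact Or.inr ⟨(hI _ _ hw).2, (hI _ _ hx).2, right _ _ hw _ hx h⟩
    · exact Or.inr ⟨(hI _ _ hw).2, (hI _ _ hx).2,
        hQ.trans (right _ _ hw _ hx h) (left _ _ hy _ hz h')⟩

section Rees

theorem mul_mem_prodSet_succ {k : ℕ} (s : S) {x : S} (hx : x ∈ prodSet S k) :
    s * x ∈ prodSet S (k + 1) := by
  induction k generalizing x with
  | zero => exact ⟨s, trivial, x, rfl⟩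
  | succ k ih =>
    obtain ⟨y, hy, z, rfl⟩ := hx
    exact ⟨s * y, ih hy, z, (mul_assoc _ _ _).symm⟩

theorem prodSet_succ_subset (k : ℕ) : prodSet S (k + 1) ⊆ prodSet S k := by
  induction k with
  | zero => exact fun _ _ => trivial
  | succ k ih =>
    rintro _ ⟨y, hy, z, rfl⟩
    exact ⟨y, ih hy, z, rfl⟩

/-- The Rees congruence of an ideal. -/
def reesCon (I : Set S) (hI : ∀ s, ∀ a ∈ I, s * a ∈ I ∧ a * s ∈ I) : Con S :=
  idealCon I hI (fun _ _ => True) ⟨fun _ => trivial, fun _ => trivial, fun _ _ => trivial⟩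
    (fun _ _ _ _ _ _ => trivial) (fun _ _ _ _ _ _ => trivial)

variable {I J : Set S} {hI : ∀ s, ∀ a ∈ I, s * a ∈ I ∧ a * s ∈ I}
  {hJ : ∀ s, ∀ a ∈ J, s * a ∈ J ∧ a * s ∈ J}

theorem reesCon_of_mem {x y : S} (hx : x ∈ I) (hy : y ∈ I) : reesCon I hI x y :=
  Or.inr ⟨hx, hy, trivial⟩

theorem reesCon_mono (hIJ : I ⊆ J) : reesCon I hI ≤ reesCon J hJ := by
  rintro x y (h | ⟨hx, hy, -⟩)
  · exact Or.inl h
  · exact reesCon_of_mem (hIJ hx) (hIJ hy)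

/-- A generator from the ideal `I` is carried into `J` by any further factor. So an array has equal
columns, or lies in `J`, or has equal rows as such a generator does. -/
theorem biCentralizes_reesCon (hIJ : ∀ s, ∀ a ∈ I, s * a ∈ J ∧ a * s ∈ J) :
    BiCentralizes ⊤ (reesCon I hI) (reesCon J hJ) := by
  intro x hx
  have key : (∀ i, x i 0 = x i 1) ∨ (∀ i j, x i j ∈ J) ∨
      ((∀ j, x 0 j = x 1 j) ∧ ∀ i j, x i j ∈ I) := by
    induction hx using termArrays_induction with
    | row a b _ => exact Or.inl fun i => by fin_cases i <;> rfl
    | col c d h =>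
      rcases h with rfl | ⟨hc, hd, -⟩
      · exact Or.inl fun i => by fin_cases i <;> rfl
      · exact Or.inr (Or.inr ⟨fun _ => rfl, fun i j => by
          fin_cases i <;> fin_cases j <;> assumption⟩)
    | mul x y _ _ hx hy =>
      rcases hx with hx | hx | ⟨-, hx⟩
      · rcases hy with hy | hy | ⟨-, hy⟩
        · exact Or.inl fun i => by simp only [Pi.mul_apply, hx, hy]
        · exact Or.inr (Or.inl fun i j => (hJ _ _ (hy i j)).1)
        · exact Or.inr (Or.inl fun i j => (hIJ _ _ (hy i j)).1)
      · exact Or.inr (Or.inl fun i j => (hJ _ _ (hx i j)).2)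
      · exact Or.inr (Or.inl fun i j => (hIJ _ _ (hx i j)).2)
  rcases key with h | h | ⟨h, -⟩
  · rw [h 0, h 1]; exact ⟨fun _ => Con.refl _ _, id⟩
  · exact ⟨fun _ => reesCon_of_mem (h _ _) (h _ _), fun _ => reesCon_of_mem (h _ _) (h _ _)⟩
  · rw [h 0, h 1]; exact ⟨id, fun _ => Con.refl _ _⟩

end Rees

namespace IsGroupKernel

variable {e : S} {K : Set S} (h : IsGroupKernel e K)

/-- `R`-relatedness after multiplying by `k` arbitrary elements on the left. -/
def rhoRel : ℕ → S → S → Prop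
  | 0, x, y => h.rho x = h.rho y
  | k + 1, x, y => ∀ s, rhoRel k (s * x) (s * y)

/-- `L`-relatedness after multiplying by `k` arbitrary elements on the right. -/
def lamRel : ℕ → S → S → Prop
  | 0, x, y => h.lam x = h.lam y
  | k + 1, x, y => ∀ s, lamRel k (x * s) (y * s)

theorem rhoRel_equivalence (k : ℕ) : Equivalence (h.rhoRel k) := by
  induction k with
  | zero => exact ⟨fun _ => rfl, Eq.symm, Eq.trans⟩
  | succ k ih => exact ⟨fun _ _ => ih.refl _, fun h s => ih.symm (h s),
      fun h h' s => ih.trans (h s) (h' s)⟩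

theorem lamRel_equivalence (k : ℕ) : Equivalence (h.lamRel k) := by
  induction k with
  | zero => exact ⟨fun _ => rfl, Eq.symm, Eq.trans⟩
  | succ k ih => exact ⟨fun _ _ => ih.refl _, fun h s => ih.symm (h s),
      fun h h' s => ih.trans (h s) (h' s)⟩

theorem rhoRel_mul_right (k : ℕ) {x : S} (hx : x ∈ K) (s : S) : h.rhoRel k (x * s) x := by
  induction k generalizing x with
  | zero => exact h.rho_mul hx s
  | succ k ih => exact fun t => by rw [← mul_assoc]; exact ih (h.mul_mem_left t hx)

theorem lamRel_mul_left (k : ℕ) {x : S} (hx : x ∈ K) (s : S) : h.lamRel k (s * x) x := by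
  induction k generalizing x with
  | zero => exact h.lam_mul hx s
  | succ k ih => exact fun t => by rw [mul_assoc]; exact ih (h.mul_mem_right t hx)

theorem rhoRel_mul_left {k : ℕ} {x y : S} (hx : x ∈ K) (hy : y ∈ K) (hxy : h.rhoRel k x y)
    (s : S) : h.rhoRel k (s * x) (s * y) := by
  cases k with
  | zero => exact h.rho_congr hx hy hxy s
  | succ k => exact fun t => by rw [← mul_assoc, ← mul_assoc]; exact hxy (t * s)

theorem lamRel_mul_right {k : ℕ} {x y : S} (hx : x ∈ K) (hy : y ∈ K) (hxy : h.lamRel k x y)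
    (s : S) : h.lamRel k (x * s) (y * s) := by
  cases k with
  | zero => exact h.lam_congr hx hy hxy s
  | succ k => exact fun t => by rw [mul_assoc, mul_assoc]; exact hxy (s * t)

theorem rhoRel_of_prodSet {k : ℕ} {x y : S}
    (hp : ∀ p ∈ prodSet S k, h.rho (p * x) = h.rho (p * y)) : h.rhoRel (k + 1) x y := by
  induction k generalizing x y with
  | zero => exact fun s => hp s trivial
  | succ k ih =>
    refine fun s => ih fun p hps => ?_
    rw [← mul_assoc, ← mul_assoc]
    exact hp _ ⟨p, hps, s, rfl⟩

theorem lamRel_of_prodSet {k : ℕ} {x y : S}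
    (hp : ∀ p ∈ prodSet S k, h.lam (x * p) = h.lam (y * p)) : h.lamRel (k + 1) x y := by
  induction k generalizing x y with
  | zero => exact fun s => hp s trivial
  | succ k ih =>
    refine fun s => ih fun p hps => ?_
    rw [mul_assoc, mul_assoc]
    exact hp _ (mul_mem_prodSet_succ s hps)

/-- The congruence on the kernel given by `rhoRel k` and `lamRel k`. -/
def actionCon (k : ℕ) : Con S :=
  idealCon K h.isIdeal.2 (fun x y => h.rhoRel k x y ∧ h.lamRel k x y)
    ⟨fun _ => ⟨(h.rhoRel_equivalence k).refl _, (h.lamRel_equivalence k).refl _⟩,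
      fun hxy => ⟨(h.rhoRel_equivalence k).symm hxy.1, (h.lamRel_equivalence k).symm hxy.2⟩,
      fun hxy hyz => ⟨(h.rhoRel_equivalence k).trans hxy.1 hyz.1,
        (h.lamRel_equivalence k).trans hxy.2 hyz.2⟩⟩
    (fun s _ hx _ hy hxy => ⟨h.rhoRel_mul_left hx hy hxy.1 s,
      (h.lamRel_equivalence k).trans (h.lamRel_mul_left k hx s)
        ((h.lamRel_equivalence k).trans hxy.2
          ((h.lamRel_equivalence k).symm (h.lamRel_mul_left k hy s)))⟩)
    (fun s _ hx _ hy hxy => ⟨(h.rhoRel_equivalence k).trans (h.rhoRel_mul_right k hx s)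
        ((h.rhoRel_equivalence k).trans hxy.1
          ((h.rhoRel_equivalence k).symm (h.rhoRel_mul_right k hy s))),
      h.lamRel_mul_right hx hy hxy.2 s⟩)

/-- A product `p` of `n + 1` elements is in `K`, so `p * x` has the left coordinate of `p` whatever
`x` is; dually on the right. -/
theorem reesCon_le_actionCon {n : ℕ} (hn : prodSet S n ⊆ K) :
    reesCon K h.isIdeal.2 ≤ h.actionCon (n + 1) := by
  rintro x y (rfl | ⟨hx, hy, -⟩)
  · exact Or.inl rfl
  · exact Or.inr ⟨hx, hy,
      h.rhoRel_of_prodSet fun p hp => by rw [h.rho_mul (hn hp), h.rho_mul (hn hp)],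
      h.lamRel_of_prodSet fun p hp => by rw [h.lam_mul (hn hp), h.lam_mul (hn hp)]⟩

/-- An array whose columns differ lies in `K`. There the left class of a product is inherited from a
first factor in `K`; otherwise the first factor has equal columns and acts on rows related at level
`k + 1`, which remain related at level `k`. -/
theorem biCentralizes_actionCon (k : ℕ) :
    BiCentralizes ⊤ (h.actionCon (k + 1)) (h.actionCon k) := by
  intro x hx
  have hR := h.rhoRel_equivalence k
  have hL := h.lamRel_equivalence k
  have key : (∀ i, x i 0 = x i 1) ∨ (∀ i j, x i j ∈ K) ∧
      ((∀ j, h.rhoRel k (x 0 j) (x 1 j)) ∨ ∀ i, h.rhoRel k (x i 0) (x i 1)) ∧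
      ((∀ j, h.lamRel k (x 0 j) (x 1 j)) ∨ ∀ i, h.lamRel k (x i 0) (x i 1)) := by
    induction hx using termArrays_induction with
    | row a b _ => exact Or.inl fun i => by fin_cases i <;> rfl
    | col c d hcd =>
      rcases hcd with rfl | ⟨hc, hd, -⟩
      · exact Or.inl fun i => by fin_cases i <;> rfl
      · exact Or.inr ⟨fun i j => by fin_cases i <;> fin_cases j <;> assumption,
          Or.inl fun _ => hR.refl _, Or.inl fun _ => hL.refl _⟩
    | mul x y hxm hym hx hy =>
      have rho_of_left : (∀ i j, x i j ∈ K) →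
          ((∀ j, h.rhoRel k (x 0 j) (x 1 j)) ∨ ∀ i, h.rhoRel k (x i 0) (x i 1)) →
          ((∀ j, h.rhoRel k ((x * y) 0 j) ((x * y) 1 j)) ∨
            ∀ i, h.rhoRel k ((x * y) i 0) ((x * y) i 1)) := fun hK hx => by
        have : ∀ i j, h.rhoRel k ((x * y) i j) (x i j) :=
          fun i j => h.rhoRel_mul_right k (hK i j) _
        exact hx.imp (fun hx j => hR.trans (this _ _) (hR.trans (hx j) (hR.symm (this _ _))))
          (fun hx j => hR.trans (this _ _) (hR.trans (hx j) (hR.symm (this _ _))))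
      have lam_of_right : (∀ i j, y i j ∈ K) →
          ((∀ j, h.lamRel k (y 0 j) (y 1 j)) ∨ ∀ i, h.lamRel k (y i 0) (y i 1)) →
          ((∀ j, h.lamRel k ((x * y) 0 j) ((x * y) 1 j)) ∨
            ∀ i, h.lamRel k ((x * y) i 0) ((x * y) i 1)) := fun hK hy => by
        have : ∀ i j, h.lamRel k ((x * y) i j) (y i j) :=
          fun i j => h.lamRel_mul_left k (hK i j) _
        exact hy.imp (fun hx j => hL.trans (this _ _) (hL.trans (hx j) (hL.symm (this _ _))))
          (fun hx j => hL.trans (this _ _) (hL.trans (hx j) (hL.symm (this _ _))))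
      rcases hx with hx | ⟨hxK, hxR, hxL⟩
      · rcases hy with hy | ⟨hyK, hyR, hyL⟩
        · exact Or.inl fun i => by simp only [Pi.mul_apply, hx, hy]
        · refine Or.inr ⟨fun i j => h.mul_mem_left _ (hyK i j), Or.inr fun i => ?_,
            lam_of_right hyK hyL⟩
          simp only [Pi.mul_apply, hx]
          rcases (termArrays_rel hym).2 i with heq | ⟨-, -, hr, -⟩
          · rw [heq]; exact hR.refl _
          · exact hr _
      · refine Or.inr ⟨fun i j => h.mul_mem_right _ (hxK i j), rho_of_left hxK hxR, ?_⟩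
        rcases hy with hy | ⟨hyK, hyR, hyL⟩
        · refine Or.inr fun i => ?_
          simp only [Pi.mul_apply, hy]
          rcases (termArrays_rel hxm).2 i with heq | ⟨-, -, -, hl⟩
          · rw [heq]; exact hL.refl _
          · exact hl _
        · exact lam_of_right hyK hyL
  rcases key with hx | ⟨hK, hxR, hxL⟩
  · rw [hx 0, hx 1]; exact ⟨fun _ => Con.refl _ _, id⟩
  · have split : ∀ {a b : S}, h.actionCon k a b → h.rhoRel k a b ∧ h.lamRel k a b := by
      rintro a b (rfl | ⟨-, -, hab⟩)
      · exact ⟨hR.refl _, hL.refl _⟩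
      · exact hab
    have r := rows_cols_implications hR hxR
    have l := rows_cols_implications hL hxL
    exact ⟨fun hh => Or.inr ⟨hK _ _, hK _ _, r.1 (split hh).1, l.1 (split hh).2⟩,
      fun hh => Or.inr ⟨hK _ _, hK _ _, r.2 (split hh).1, l.2 (split hh).2⟩⟩

/-- The congruence on the kernel whose classes are the cosets of `N` in the `H`-classes. -/
def cosetCon (N : Subgroup h.Corner) [N.Normal] : Con S :=
  idealCon K h.isIdeal.2
    (fun x y => h.rho x = h.rho y ∧ h.lam x = h.lam y ∧ (h.proj x : h.Corner ⧸ N) = h.proj y)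
    ⟨fun _ => ⟨rfl, rfl, rfl⟩, fun hxy => ⟨hxy.1.symm, hxy.2.1.symm, hxy.2.2.symm⟩,
      fun hxy hyz => ⟨hxy.1.trans hyz.1, hxy.2.1.trans hyz.2.1, hxy.2.2.trans hyz.2.2⟩⟩
    (fun s x hx y hy hxy => ⟨h.rho_congr hx hy hxy.1 s,
      by rw [h.lam_mul hx, h.lam_mul hy, hxy.2.1],
      by rw [h.proj_mul_left hx, h.proj_mul_left hy, QuotientGroup.mk_mul, hxy.1, hxy.2.2,
        QuotientGroup.mk_mul]⟩)
    (fun s x hx y hy hxy => ⟨by rw [h.rho_mul hx, h.rho_mul hy, hxy.1],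
      h.lam_congr hx hy hxy.2.1 s,
      by rw [h.proj_mul_right hx, h.proj_mul_right hy, QuotientGroup.mk_mul, hxy.2.1, hxy.2.2,
        QuotientGroup.mk_mul]⟩)

/-- Elements are related if they are congruent modulo `M` after multiplication into `eSe`. -/
def contextCon (M : Subgroup h.Corner) : Con S where
  r x y := ∀ s t, (h.proj (s * x * t) : h.Corner ⧸ M) = h.proj (s * y * t)
  iseqv := ⟨fun _ _ _ => rfl, fun hxy s t => (hxy s t).symm,
    fun hxy hyz s t => (hxy s t).trans (hyz s t)⟩
  mul' := fun {w x y z} hwx hyz s t => by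
    have h1 := hwx s (y * t)
    have h2 := hyz (s * x) t
    simp only [mul_assoc] at h1 h2 ⊢
    exact h1.trans h2

theorem contextCon_top : h.contextCon ⊤ = ⊤ :=
  top_le_iff.1 fun _ _ _ _ _ => QuotientGroup.eq.2 trivial

theorem proj_e_mul_e (x : S) : h.proj (e * x * e) = h.proj x :=
  h.proj_eq_of_eq (by simp only [mul_assoc, h.idem]; rw [← mul_assoc, h.idem])

theorem contextCon_proj {M : Subgroup h.Corner} {x y : S} (hxy : h.contextCon M x y) :
    (h.proj x : h.Corner ⧸ M) = h.proj y := by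
  have := hxy e e
  rwa [h.proj_e_mul_e, h.proj_e_mul_e] at this

theorem cosetCon_le_contextCon (N : Subgroup h.Corner) [N.Normal] :
    h.cosetCon N ≤ h.contextCon N := by
  rintro x y (rfl | ⟨hx, hy, hr, hl, hp⟩)
  · exact Con.refl _ _
  · intro s t
    rw [h.proj_mul_mul hx, h.proj_mul_mul hy, hr, hl]
    simp only [QuotientGroup.mk_mul, hp]

theorem cosetCon_bot : h.cosetCon ⊥ = ⊥ := by
  refine le_bot_iff.1 ?_
  rintro x y (rfl | ⟨hx, hy, hr, hl, hp⟩)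
  · rfl
  · refine h.ext hx hy hr hl ?_
    have := QuotientGroup.eq.1 hp
    exact (inv_mul_eq_one.1 (Subgroup.mem_bot.1 this))

theorem actionCon_zero_le_cosetCon : h.actionCon 0 ≤ h.cosetCon ⊤ := by
  rintro x y (rfl | ⟨hx, hy, hr, hl⟩)
  · exact Or.inl rfl
  · exact Or.inr ⟨hx, hy, hr, hl, QuotientGroup.eq.2 trivial⟩

end IsGroupKernel

/-! ### Arrays over a group modulo `⁅M, N⁆` -/

section GroupArrays

variable {G : Type u} [Group G] (M N : Subgroup G) [M.Normal] [N.Normal]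

/-- A set of arrays over a group that contains `M(M, N)` and satisfies the term condition modulo
`[M, N]`. -/
def IsCommutatorArray (p : Fin 2 → Fin 2 → G) : Prop :=
  (∀ j, (p 0 j : G ⧸ M) = p 1 j) ∧ (∀ i, (p i 0 : G ⧸ N) = p i 1) ∧
    (p 0 0 : G ⧸ ⁅M, N⁆)⁻¹ * (p 0 1 : G ⧸ ⁅M, N⁆) =
      (p 1 0 : G ⧸ ⁅M, N⁆)⁻¹ * (p 1 1 : G ⧸ ⁅M, N⁆)

variable {M N}

/-- The row quotient of `p`, conjugated by `q 0 0`, lies in `N`, and the column quotient of `q` lies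
in `M`. They commute modulo `⁅M, N⁆`, so the row quotients of the product agree. -/
theorem IsCommutatorArray.mul {p q : Fin 2 → Fin 2 → G} (hp : IsCommutatorArray M N p)
    (hq : IsCommutatorArray M N q) : IsCommutatorArray M N (p * q) := by
  obtain ⟨pM, pN, pC⟩ := hp
  obtain ⟨qM, qN, qC⟩ := hq
  refine ⟨fun j => ?_, fun i => ?_, ?_⟩
  · simp only [Pi.mul_apply, QuotientGroup.mk_mul, pM, qM]
  · simp only [Pi.mul_apply, QuotientGroup.mk_mul, pN, qN]
  · simp only [Pi.mul_apply, QuotientGroup.mk_mul]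
    have hm : (q 0 0)⁻¹ * q 1 0 ∈ M := QuotientGroup.eq.1 (qM 0)
    have hn : (q 0 0)⁻¹ * ((p 0 0)⁻¹ * p 0 1) * q 0 0 ∈ N := by
      simpa using Subgroup.Normal.conj_mem ‹N.Normal› _ (QuotientGroup.eq.1 (pN 0)) (q 0 0)⁻¹
    have hc := (QuotientGroup.eq_one_iff (N := ⁅M, N⁆) _).2
      (Subgroup.commutator_mem_commutator hm hn)
    rw [← QuotientGroup.mk'_apply, map_commutatorElement,
      commutatorElement_eq_one_iff_mul_comm] at hc
    simp only [QuotientGroup.mk'_apply, QuotientGroup.mk_mul, QuotientGroup.mk_inv] at hc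
    generalize (p 0 0 : G ⧸ ⁅M, N⁆) = p00 at *
    generalize (p 0 1 : G ⧸ ⁅M, N⁆) = p01 at *
    generalize (p 1 0 : G ⧸ ⁅M, N⁆) = p10 at *
    generalize (p 1 1 : G ⧸ ⁅M, N⁆) = p11 at *
    generalize (q 0 0 : G ⧸ ⁅M, N⁆) = q00 at *
    generalize (q 0 1 : G ⧸ ⁅M, N⁆) = q01 at *
    generalize (q 1 0 : G ⧸ ⁅M, N⁆) = q10 at *
    generalize (q 1 1 : G ⧸ ⁅M, N⁆) = q11 at *
    calc (p00 * q00)⁻¹ * (p01 * q01)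
        = (q00⁻¹ * (p00⁻¹ * p01) * q00) * (q00⁻¹ * q01) := by group
      _ = (q00⁻¹ * q10)⁻¹ * ((q00⁻¹ * q10) * (q00⁻¹ * (p00⁻¹ * p01) * q00)) *
            (q00⁻¹ * q01) := by group
      _ = (q00⁻¹ * q10)⁻¹ * ((q00⁻¹ * (p10⁻¹ * p11) * q00) * (q00⁻¹ * q10)) *
            (q10⁻¹ * q11) := by rw [hc, pC, qC]
      _ = (p10 * q10)⁻¹ * (p11 * q11) := by group

theorem isCommutatorArray_of_rows {p : Fin 2 → Fin 2 → G} (hM : ∀ j, (p 0 j : G ⧸ M) = p 1 j)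
    (hp : ∀ i, p i 0 = p i 1) : IsCommutatorArray M N p :=
  ⟨hM, fun i => by rw [hp], by rw [hp, hp, inv_mul_cancel, inv_mul_cancel]⟩

end GroupArrays

namespace IsGroupKernel

variable {e : S} {K : Set S} (h : IsGroupKernel e K)

/-- `rho` need not respect `contextCon M`, but this group element is the quotient of the group
coordinates of `u * y` and `y`, which do. -/
theorem contextCon_mul_rho {M : Subgroup h.Corner} [M.Normal] {u u' y y' : S} (hy : y ∈ K)
    (hy' : y' ∈ K) (hu : h.contextCon M u u') (hyy : h.contextCon M y y') :
    (h.proj (u * h.rho y) : h.Corner ⧸ M) = h.proj (u' * h.rho y') := by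
  rw [eq_mul_inv_of_mul_eq (h.proj_mul_left hy u).symm,
    eq_mul_inv_of_mul_eq (h.proj_mul_left hy' u').symm]
  simp only [QuotientGroup.mk_mul, QuotientGroup.mk_inv, h.contextCon_proj hyy,
    h.contextCon_proj ((h.contextCon M).mul hu hyy)]

theorem contextCon_lam_mul {M : Subgroup h.Corner} [M.Normal] {w w' x x' : S} (hx : x ∈ K)
    (hx' : x' ∈ K) (hw : h.contextCon M w w') (hxx : h.contextCon M x x') :
    (h.proj (h.lam x * w) : h.Corner ⧸ M) = h.proj (h.lam x' * w') := by
  rw [eq_inv_mul_of_mul_eq (h.proj_mul_right hx w).symm,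
    eq_inv_mul_of_mul_eq (h.proj_mul_right hx' w').symm]
  simp only [QuotientGroup.mk_mul, QuotientGroup.mk_inv, h.contextCon_proj hxx,
    h.contextCon_proj ((h.contextCon M).mul hxx hw)]

theorem contextCon_lam_mul_rho {M : Subgroup h.Corner} [M.Normal] {x x' y y' : S} (hx : x ∈ K)
    (hx' : x' ∈ K) (hy : y ∈ K) (hy' : y' ∈ K) (hxx : h.contextCon M x x')
    (hyy : h.contextCon M y y') :
    (h.proj (h.lam x * h.rho y) : h.Corner ⧸ M) = h.proj (h.lam x' * h.rho y') := by
  have h1 : ∀ {x y}, x ∈ K → y ∈ K →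
      h.proj (h.lam x * h.rho y) = (h.proj x)⁻¹ * h.proj (x * y) * (h.proj y)⁻¹ := by
    intro x y hx hy
    rw [h.proj_mul hx hy]; group
  rw [h1 hx hy, h1 hx' hy']
  simp only [QuotientGroup.mk_mul, QuotientGroup.mk_inv, h.contextCon_proj hxx,
    h.contextCon_proj hyy, h.contextCon_proj ((h.contextCon M).mul hxx hyy)]

/-- An array whose columns differ lies in `K`, its outer coordinates agree along rows, and its group
coordinates form a commutator array. Under products the sandwich entries contribute an array with
equal columns and rows congruent modulo `M`. -/
theorem biCentralizes_cosetCon (M N : Subgroup h.Corner) [M.Normal] [N.Normal] :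
    BiCentralizes (h.contextCon M) (h.cosetCon N) (h.cosetCon ⁅M, N⁆) := by
  intro x hx
  have key : (∀ i, x i 0 = x i 1) ∨ (∀ i j, x i j ∈ K) ∧
      (∀ i, h.rho (x i 0) = h.rho (x i 1)) ∧ (∀ i, h.lam (x i 0) = h.lam (x i 1)) ∧
      IsCommutatorArray M N fun i j => h.proj (x i j) := by
    induction hx using termArrays_induction with
    | row a b _ => exact Or.inl fun i => by fin_cases i <;> rfl
    | col c d hcd =>
      rcases hcd with rfl | ⟨hc, hd, hr, hl, hp⟩
      · exact Or.inl fun i => by fin_cases i <;> rfl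
      · exact Or.inr ⟨fun i j => by fin_cases i <;> fin_cases j <;> assumption,
          fun i => by fin_cases i <;> exact hr, fun i => by fin_cases i <;> exact hl,
          fun j => rfl, fun i => by fin_cases i <;> exact hp, rfl⟩
    | mul x y hxm hym hx hy =>
      have hxM := (termArrays_rel hxm).1
      have hyM := (termArrays_rel hym).1
      rcases hx with hx | ⟨hxK, hxR, hxL, hxp⟩
      · rcases hy with hy | ⟨hyK, hyR, hyL, hyp⟩
        · exact Or.inl fun i => by simp only [Pi.mul_apply, hx, hy]
        · refine Or.inr ⟨fun i j => h.mul_mem_left _ (hyK i j), fun i => ?_, fun i => ?_, ?_⟩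
          · simp only [Pi.mul_apply, hx]
            exact h.rho_congr (hyK _ _) (hyK _ _) (hyR i) _
          · simp only [Pi.mul_apply]
            rw [h.lam_mul (hyK _ _), h.lam_mul (hyK _ _), hyL]
          · have hrow : IsCommutatorArray M N fun i j => h.proj (x i j * h.rho (y i j)) :=
              isCommutatorArray_of_rows
                (fun j => h.contextCon_mul_rho (hyK _ _) (hyK _ _) (hxM j) (hyM j))
                (fun i => by rw [hx, hyR])
            convert hrow.mul hyp using 1
            ext i j : 2
            exact h.proj_mul_left (hyK _ _) _
      · rcases hy with hy | ⟨hyK, hyR, hyL, hyp⟩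
        · refine Or.inr ⟨fun i j => h.mul_mem_right _ (hxK i j), fun i => ?_, fun i => ?_, ?_⟩
          · simp only [Pi.mul_apply]
            rw [h.rho_mul (hxK _ _), h.rho_mul (hxK _ _), hxR]
          · simp only [Pi.mul_apply, hy]
            exact h.lam_congr (hxK _ _) (hxK _ _) (hxL i) _
          · have hrow : IsCommutatorArray M N fun i j => h.proj (h.lam (x i j) * y i j) :=
              isCommutatorArray_of_rows
                (fun j => h.contextCon_lam_mul (hxK _ _) (hxK _ _) (hyM j) (hxM j))
                (fun i => by rw [hy, hxL])
            convert hxp.mul hrow using 1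
            ext i j : 2
            exact h.proj_mul_right (hxK _ _) _
        · refine Or.inr ⟨fun i j => h.mul_mem_right _ (hxK i j), fun i => ?_, fun i => ?_, ?_⟩
          · simp only [Pi.mul_apply]
            rw [h.rho_mul (hxK _ _), h.rho_mul (hxK _ _), hxR]
          · simp only [Pi.mul_apply]
            rw [h.lam_mul (hyK _ _), h.lam_mul (hyK _ _), hyL]
          · have hrow : IsCommutatorArray M N
                fun i j => h.proj (h.lam (x i j) * h.rho (y i j)) :=
              isCommutatorArray_of_rows
                (fun j => h.contextCon_lam_mul_rho (hxK _ _) (hxK _ _) (hyK _ _) (hyK _ _)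
                  (hxM j) (hyM j))
                (fun i => by rw [hxL, hyR])
            convert (hxp.mul hrow).mul hyp using 1
            ext i j : 2
            exact h.proj_mul (hxK _ _) (hyK _ _)
  rcases key with hx | ⟨hK, hR, hL, hM, hN, hC⟩
  · rw [hx 0, hx 1]; exact ⟨fun _ => Con.refl _ _, id⟩
  · have split : ∀ {a b : S}, h.cosetCon ⁅M, N⁆ a b → h.rho a = h.rho b ∧ h.lam a = h.lam b ∧
        (h.proj a : h.Corner ⧸ ⁅M, N⁆) = h.proj b := by
      rintro a b (rfl | ⟨-, -, hab⟩)
      · exact ⟨rfl, rfl, rfl⟩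
      · exact hab
    refine ⟨fun hh => Or.inr ⟨hK _ _, hK _ _, hR 1, hL 1, ?_⟩, fun hh => Or.inr ⟨hK _ _, hK _ _,
      by rw [← hR, ← hR, (split hh).1], by rw [← hL, ← hL, (split hh).2.1], ?_⟩⟩
    · dsimp only at hC
      rw [(split hh).2.2, inv_mul_cancel] at hC
      exact inv_mul_eq_one.1 hC.symm
    · dsimp only at hC
      rw [(split hh).2.2] at hC
      exact mul_left_cancel hC

end IsGroupKernel

/-! ### Solvability and one-sided nilpotence -/

section Chains

variable {e : S} {K : Set S}

/-- A property of congruences that passes to centralized ones holds for the `H`-classes of the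
kernel. -/
theorem IsGroupKernel.chain_cosetCon_top (h : IsGroupKernel e K) {n : ℕ} (hn : prodSet S n ⊆ K)
    {P : Con S → Prop} (top : P ⊤) (mono : ∀ α β, α ≤ β → P α → P β)
    (step : ∀ α δ, BiCentralizes ⊤ α δ → P α → P δ) : P (h.cosetCon ⊤) := by
  have hI : ∀ k, ∀ s, ∀ a ∈ prodSet S k ∪ K, s * a ∈ prodSet S k ∪ K ∧ a * s ∈ prodSet S k ∪ K := by
    rintro k s a (ha | ha)
    · exact ⟨Or.inl (prodSet_succ_subset k (mul_mem_prodSet_succ s ha)),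
        Or.inl (prodSet_succ_subset k ⟨a, ha, s, rfl⟩)⟩
    · exact ⟨Or.inr (h.mul_mem_left s ha), Or.inr (h.mul_mem_right s ha)⟩
  -- First descend through the ideals `Sᵏ⁺¹ ∪ K`, starting with all of `S`.
  have hrees : ∀ k, P (reesCon _ (hI k)) := by
    intro k
    induction k with
    | zero => exact mono _ _ (fun _ _ _ => reesCon_of_mem (Or.inl trivial) (Or.inl trivial)) top
    | succ k ih =>
      refine step _ _ (biCentralizes_reesCon ?_) ih
      rintro s a (ha | ha)
      · exact ⟨Or.inl (mul_mem_prodSet_succ s ha), Or.inl ⟨a, ha, s, rfl⟩⟩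
      · exact ⟨Or.inr (h.mul_mem_left s ha), Or.inr (h.mul_mem_right s ha)⟩
  -- The level runs downward: at `n + 1` the congruence contains the Rees congruence of `K`, at `0`
  -- only the outer coordinates are compared.
  have haction : ∀ k ≤ n + 1, P (h.actionCon k) := by
    intro k hk
    induction hk using Nat.decreasingInduction with
    | self =>
      exact mono _ _ ((reesCon_mono (Set.union_subset hn le_rfl)).trans
        (h.reesCon_le_actionCon hn)) (hrees n)
    | of_succ k _ ih => exact step _ _ (h.biCentralizes_actionCon k) ih
  exact mono _ _ h.actionCon_zero_le_cosetCon (haction 0 (Nat.zero_le _))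

theorem solvable_of_isGroupKernel (h : IsGroupKernel e K) {n : ℕ} (hn : prodSet S n ⊆ K)
    (hG : Group.IsSolvable h.Corner) : Solvable S := by
  have key : ∀ k, ∃ d, derivedCon S d ≤ h.cosetCon (derivedSeries h.Corner k) := by
    intro k
    induction k with
    | zero =>
      exact h.chain_cosetCon_top hn (P := fun α => ∃ d, derivedCon S d ≤ α) ⟨0, le_rfl⟩
        (fun α β hαβ ⟨d, hd⟩ => ⟨d, hd.trans hαβ⟩) fun α δ hC ⟨d, hd⟩ =>
          ⟨d + 1, commutator_le (hC.centralizes.mono le_top hd)⟩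
    | succ k ih =>
      obtain ⟨d, hd⟩ := ih
      -- Both arguments must shrink here, so the derived congruence is used inside `contextCon` and
      -- inside `cosetCon`.
      exact ⟨d + 1, commutator_le ((h.biCentralizes_cosetCon _ _).centralizes.mono
        (hd.trans (h.cosetCon_le_contextCon _)) hd)⟩
  obtain ⟨k, hk⟩ := hG.solvable
  obtain ⟨d, hd⟩ := key k
  simp only [hk, h.cosetCon_bot] at hd
  exact ⟨d, le_bot_iff.1 hd⟩

theorem leftNilpotent_of_isGroupKernel (h : IsGroupKernel e K) {n : ℕ} (hn : prodSet S n ⊆ K)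
    (hG : Group.IsNilpotent h.Corner) : LeftNilpotent S := by
  have key : ∀ k, ∃ d, leftSeries S d ≤
      h.cosetCon ((⊤ : Subgroup h.Corner).lowerCentralSeries k) := by
    intro k
    induction k with
    | zero =>
      exact h.chain_cosetCon_top hn (P := fun α => ∃ d, leftSeries S d ≤ α) ⟨0, le_rfl⟩
        (fun α β hαβ ⟨d, hd⟩ => ⟨d, hd.trans hαβ⟩) fun α δ hC ⟨d, hd⟩ =>
          ⟨d + 1, commutator_le (hC.centralizes.mono le_rfl hd)⟩
    | succ k ih =>
      obtain ⟨d, hd⟩ := ih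
      -- With `M = ⊤` the first argument is the total congruence.
      have := (h.biCentralizes_cosetCon ⊤ _).centralizes.mono h.contextCon_top.ge hd
      simp only [Subgroup.commutator_comm ⊤] at this
      exact ⟨d + 1, commutator_le this⟩
  obtain ⟨k, hk⟩ := Subgroup.nilpotent_iff_lowerCentralSeries.1 hG
  obtain ⟨d, hd⟩ := key k
  simp only [hk, h.cosetCon_bot] at hd
  exact ⟨d, le_bot_iff.1 hd⟩

theorem rightNilpotent_of_isGroupKernel (h : IsGroupKernel e K) {n : ℕ} (hn : prodSet S n ⊆ K)
    (hG : Group.IsNilpotent h.Corner) : RightNilpotent S := by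
  have key : ∀ k, ∃ d, rightSeries S d ≤
      h.cosetCon ((⊤ : Subgroup h.Corner).lowerCentralSeries k) := by
    intro k
    induction k with
    | zero =>
      exact h.chain_cosetCon_top hn (P := fun α => ∃ d, rightSeries S d ≤ α) ⟨0, le_rfl⟩
        (fun α β hαβ ⟨d, hd⟩ => ⟨d, hd.trans hαβ⟩) fun α δ hC ⟨d, hd⟩ =>
          ⟨d + 1, commutator_le (hC.centralizes_swap.mono hd le_rfl)⟩
    | succ k ih =>
      obtain ⟨d, hd⟩ := ih
      have := (h.biCentralizes_cosetCon ⊤ _).centralizes_swap.mono hd h.contextCon_top.ge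
      simp only [Subgroup.commutator_comm ⊤] at this
      exact ⟨d + 1, commutator_le this⟩
  obtain ⟨k, hk⟩ := Subgroup.nilpotent_iff_lowerCentralSeries.1 hG
  obtain ⟨d, hd⟩ := key k
  simp only [hk, h.cosetCon_bot] at hd
  exact ⟨d, le_bot_iff.1 hd⟩

end Chains

end Congruences

/-! ### Host–Kra filtrations on cubes -/

section Filtration

variable {G : Type u} [Group G]

/-- The three subgroups lemma, applied in the quotient by `N`. -/
theorem commutator_commutator_le_of_rotate {A B C N : Subgroup G} [N.Normal]
    (h1 : ⁅⁅B, C⁆, A⁆ ≤ N) (h2 : ⁅⁅C, A⁆, B⁆ ≤ N) : ⁅⁅A, B⁆, C⁆ ≤ N := by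
  have key : ∀ L : Subgroup G, L.map (QuotientGroup.mk' N) = ⊥ ↔ L ≤ N := fun L => by
    rw [Subgroup.map_eq_bot_iff, QuotientGroup.ker_mk']
  rw [← key] at h1 h2 ⊢
  simp only [Subgroup.map_commutator] at h1 h2 ⊢
  exact Subgroup.commutator_commutator_eq_bot_of_rotate h1 h2

theorem commutator_lowerCentralSeries_le (a b : ℕ) :
    ⁅(⊤ : Subgroup G).lowerCentralSeries a, (⊤ : Subgroup G).lowerCentralSeries b⁆ ≤
      (⊤ : Subgroup G).lowerCentralSeries (a + b + 1) := by
  induction b generalizing a with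
  | zero => exact le_rfl
  | succ b ih =>
    rw [Subgroup.commutator_comm, Subgroup.lowerCentralSeries_succ _ b]
    refine commutator_commutator_le_of_rotate ?_ ?_
    · rw [Subgroup.commutator_comm ⊤, ← Subgroup.lowerCentralSeries_succ]
      exact (ih (a + 1)).trans_eq (by congr 1; omega)
    · exact Subgroup.commutator_mono (ih a) le_rfl

/-- A descending sequence of subgroups with `[Hᵢ, Hⱼ] ≤ Hᵢ₊ⱼ`. -/
structure GroupFiltration (G : Type u) [Group G] where
  term : ℕ → Subgroup G
  antitone : Antitone term
  commutator_le : ∀ i j, ⁅term i, term j⁆ ≤ term (i + j)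

namespace GroupFiltration

variable {A : Type u} [Group A]

theorem conj_mem (H : GroupFiltration G) {k : ℕ} {a g : G} (ha : a ∈ H.term k)
    (hg : g ∈ H.term 0) : g * a * g⁻¹ ∈ H.term k := by
  have := H.commutator_le 0 k (Subgroup.commutator_mem_commutator hg ha)
  rw [Nat.zero_add, commutatorElement_def] at this
  simpa using mul_mem this ha

theorem conj_mem' (H : GroupFiltration G) {k : ℕ} {a g : G} (ha : a ∈ H.term k)
    (hg : g ∈ H.term 0) : g⁻¹ * a * g ∈ H.term k := by
  simpa using H.conj_mem ha (inv_mem hg)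

theorem mem_zero (H : GroupFiltration G) {k : ℕ} {a : G} (ha : a ∈ H.term k) : a ∈ H.term 0 :=
  H.antitone (Nat.zero_le k) ha

/-- The preimage of a filtration. -/
def comap (H : GroupFiltration G) (f : A →* G) : GroupFiltration A where
  term k := (H.term k).comap f
  antitone _ _ h := Subgroup.comap_mono (H.antitone h)
  commutator_le i j := Subgroup.commutator_le.2 fun x hx y hy => by
    rw [Subgroup.mem_comap, map_commutatorElement]
    exact H.commutator_le i j (Subgroup.commutator_mem_commutator hx hy)

/-- The filtration of those elements of `A` whose images under two homomorphisms lie in `Hₖ` and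
differ by an element of `Hₖ₊₁`. -/
def extend (H : GroupFiltration G) (p q : A →* G) : GroupFiltration A where
  term k :=
    { carrier := {x | p x ∈ H.term k ∧ (p x)⁻¹ * q x ∈ H.term (k + 1)}
      one_mem' := by simp [one_mem]
      mul_mem' := fun {x y} hx hy => by
        refine ⟨by rw [map_mul]; exact mul_mem hx.1 hy.1, ?_⟩
        have := mul_mem (H.conj_mem' hx.2 (H.mem_zero hy.1)) hy.2
        rw [map_mul, map_mul]
        convert this using 1; group
      inv_mem' := fun {x} hx => by
        refine ⟨by rw [map_inv]; exact inv_mem hx.1, ?_⟩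
        have := H.conj_mem (inv_mem hx.2) (H.mem_zero hx.1)
        rw [map_inv, map_inv]
        convert this using 1; group }
  antitone _ _ h _ hx := ⟨H.antitone h hx.1, H.antitone (Nat.succ_le_succ h) hx.2⟩
  commutator_le i j := Subgroup.commutator_le.2 fun x hx y hy => by
    refine ⟨?_, ?_⟩
    · rw [map_commutatorElement]
      exact H.commutator_le i j (Subgroup.commutator_mem_commutator hx.1 hy.1)
    · rw [map_commutatorElement, map_commutatorElement]
      have hqy : q y ∈ H.term j := by
        simpa using mul_mem hy.1 (H.antitone (Nat.le_succ j) hy.2)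
      have h1 := H.commutator_le (i + 1) j (Subgroup.commutator_mem_commutator hx.2 hqy)
      have h2 := H.commutator_le i (j + 1) (Subgroup.commutator_mem_commutator hx.1 hy.2)
      have h3 : p x * p y * (p x)⁻¹ * (p y)⁻¹ ∈ H.term 0 :=
        H.mem_zero (H.commutator_le i j (Subgroup.commutator_mem_commutator hx.1 hy.1))
      rw [show i + 1 + j = i + j + 1 by omega] at h1
      -- Writing `q x = p x * u` and `q y = p y * v`, the commutator `⁅q x, q y⁆` is `⁅p x, p y⁆`
      -- with a conjugate of `⁅u, q y⁆` on its left and one of `⁅p x, v⁆` on its right.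
      have h4 := mul_mem (H.conj_mem' (H.conj_mem h1 (H.mem_zero hx.1)) h3)
        (H.conj_mem h2 (H.mem_zero hy.1))
      convert h4 using 1
      simp only [commutatorElement_def]
      group

end GroupFiltration

theorem add_sub_one_div_le {D : ℕ} (hD : 0 < D) {s t : ℕ} (hs : 0 < s) (ht : 0 < t) :
    (s + t - 1) / D ≤ (s - 1) / D + (t - 1) / D + 1 := by
  have h1 := Nat.lt_mul_div_succ (s - 1) hD
  have h2 := Nat.lt_mul_div_succ (t - 1) hD
  refine Nat.le_of_lt_succ (Nat.div_lt_of_lt_mul ?_)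
  have h3 : D * ((s - 1) / D + (t - 1) / D + 1).succ =
      D * ((s - 1) / D + 1) + D * ((t - 1) / D + 1) := by
    rw [Nat.succ_eq_add_one]; ring
  omega

/-- The lower central series, every term repeated `D` times. -/
def slowCentralSeries (G : Type u) [Group G] {D : ℕ} (hD : 0 < D) : GroupFiltration G where
  -- Terms `0` to `D` are the whole group, so values of functions of at most `D` coordinates are
  -- unrestricted.
  term k := (⊤ : Subgroup G).lowerCentralSeries ((k - 1) / D)
  antitone _ _ h := (⊤ : Subgroup G).lowerCentralSeries_antitone
    (Nat.div_le_div_right (Nat.sub_le_sub_right h 1))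
  commutator_le s t := by
    rcases Nat.eq_zero_or_pos s with rfl | hs
    · rw [Nat.zero_add]; exact Subgroup.commutator_le_right _ _
    rcases Nat.eq_zero_or_pos t with rfl | ht
    · exact Subgroup.commutator_le_left _ _
    exact (commutator_lowerCentralSeries_le _ _).trans
      ((⊤ : Subgroup G).lowerCentralSeries_antitone (add_sub_one_div_le hD hs ht))

/-- The restriction of functions on a cube to a face. -/
def face (G : Type u) [Group G] (n : ℕ) (b : Bool) :
    ((Fin (n + 1) → Bool) → G) →* ((Fin n → Bool) → G) where
  toFun f r := f (Fin.snoc r b)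
  map_one' := rfl
  map_mul' _ _ := rfl

/-- The Host–Kra filtration on the functions on a cube. -/
def GroupFiltration.cube (H : GroupFiltration G) : (n : ℕ) → GroupFiltration ((Fin n → Bool) → G)
  | 0 => H.comap (Pi.evalMonoidHom _ fun _ => true)
  | n + 1 => (H.cube n).extend (face G n false) (face G n true)

/-- Passing to the quotient of opposite faces lowers the dimension by one and raises the level by
one, and keeps the corner value since the other face is trivial. -/
theorem GroupFiltration.apply_mem_of_mem_cube (H : GroupFiltration G) {n k : ℕ}
    {f : (Fin n → Bool) → G} (hf : f ∈ (H.cube n).term k)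
    (h1 : ∀ r, r ≠ (fun _ => true) → f r = 1) : f (fun _ => true) ∈ H.term (n + k) := by
  induction n generalizing k with
  | zero => rw [Nat.zero_add]; exact hf
  | succ n ih =>
    have hfalse : ∀ r : Fin n → Bool, f (Fin.snoc r false) = 1 := fun r => h1 _ fun h => by
      have := congrFun h (Fin.last n)
      simp at this
    have hsnoc : (Fin.snoc (fun _ => true : Fin n → Bool) true : Fin (n + 1) → Bool) =
        fun _ => true := by
      ext i
      refine Fin.lastCases ?_ (fun i => ?_) i
      · exact Fin.snoc_last (n := n) (α := fun _ => Bool) true _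
      · exact Fin.snoc_castSucc (n := n) (α := fun _ => Bool) true _ i
    have hd : ∀ r, ((face G n false f)⁻¹ * face G n true f) r = f (Fin.snoc r true) := fun r => by
      change (f (Fin.snoc r false))⁻¹ * f (Fin.snoc r true) = _
      rw [hfalse, inv_one, one_mul]
    have := ih hf.2 fun r hr => by
      rw [hd]
      refine h1 _ fun h => hr ?_
      ext i
      have := congrFun h i.castSucc
      rwa [Fin.snoc_castSucc] at this
    rwa [hd, hsnoc, show n + (k + 1) = n + 1 + k by omega] at this

/-- The quotient of opposite faces is trivial in a direction outside `T`. In a direction of `T` it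
depends on one coordinate fewer, which pays for the level gained. -/
theorem GroupFiltration.mem_cube_of_dependsOn (H : GroupFiltration G) {n k : ℕ}
    {f : (Fin n → Bool) → G} {T : Finset (Fin n)} (hT : DependsOn f (T : Set (Fin n)))
    (hf : ∀ v, f v ∈ H.term (T.card + k)) : f ∈ (H.cube n).term k := by
  induction n generalizing k with
  | zero => exact H.antitone (Nat.le_add_left _ _) (hf _)
  | succ n ih =>
    set T' : Finset (Fin n) := Finset.univ.filter fun i => i.castSucc ∈ T with hT'
    have hmap : T'.map Fin.castSuccEmb ⊆ T.erase (Fin.last n) := by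
      intro i hi
      obtain ⟨j, hj, rfl⟩ := Finset.mem_map.1 hi
      exact Finset.mem_erase.2 ⟨(Fin.castSucc_lt_last j).ne, (Finset.mem_filter.1 hj).2⟩
    have hcard := Finset.card_le_card hmap
    rw [Finset.card_map] at hcard
    have hcard' : T'.card ≤ T.card := hcard.trans (Finset.card_erase_le)
    have hsnoc : ∀ (r r' : Fin n → Bool) (b : Bool), (∀ i ∈ (T' : Set (Fin n)), r i = r' i) →
        f (Fin.snoc r b) = f (Fin.snoc r' b) := by
      intro r r' b hr
      refine hT fun i => ?_
      refine Fin.lastCases (fun _ => ?_) (fun i hi => ?_) i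
      · rw [Fin.snoc_last, Fin.snoc_last]
      · rw [Fin.snoc_castSucc, Fin.snoc_castSucc]
        exact hr i (by simpa [hT'] using hi)
    refine ⟨ih (T := T') (fun r r' hr => hsnoc r r' false hr)
      fun v => H.antitone (Nat.add_le_add_right hcard' k) (hf _), ?_⟩
    by_cases hlast : Fin.last n ∈ T
    · refine ih (T := T') (fun r r' hr => ?_) fun v => ?_
      · change (f _)⁻¹ * f _ = (f _)⁻¹ * f _
        rw [hsnoc r r' false hr, hsnoc r r' true hr]
      · rw [Finset.card_erase_of_mem hlast] at hcard
        have hpos := Finset.card_pos.2 ⟨_, hlast⟩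
        refine H.antitone (show T'.card + (k + 1) ≤ T.card + k by omega) ?_
        exact mul_mem (inv_mem (hf _)) (hf _)
    · have : (face G n false f)⁻¹ * face G n true f = 1 := by
        ext r
        change (f _)⁻¹ * f _ = 1
        rw [inv_mul_eq_one]
        refine hT fun i => ?_
        refine Fin.lastCases (fun hi => absurd hi hlast) (fun i _ => ?_) i
        rw [Fin.snoc_castSucc, Fin.snoc_castSucc]
      rw [this]; exact one_mem _

end Filtration

/-! ### Functions of few coordinates -/

section Local

/-- The function only depends on at most `d` of its arguments. -/
def IsLocal {n : ℕ} {X : Type u} (d : ℕ) (f : (Fin n → Bool) → X) : Prop :=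
  ∃ T : Finset (Fin n), T.card ≤ d ∧ DependsOn f (T : Set (Fin n))

variable {n : ℕ} {X Y Z : Type u}

theorem IsLocal.mono {d d' : ℕ} {f : (Fin n → Bool) → X} (hf : IsLocal d f) (h : d ≤ d') :
    IsLocal d' f :=
  hf.imp fun _ hT => ⟨hT.1.trans h, hT.2⟩

theorem IsLocal.map {d : ℕ} {f : (Fin n → Bool) → X} (hf : IsLocal d f) (F : X → Y) :
    IsLocal d fun v => F (f v) :=
  hf.imp fun _ hT => ⟨hT.1, fun _ _ hvw => congrArg F (hT.2 hvw)⟩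

theorem IsLocal.map₂ {d d' : ℕ} {f : (Fin n → Bool) → X} {g : (Fin n → Bool) → Y}
    (hf : IsLocal d f) (hg : IsLocal d' g) (F : X → Y → Z) :
    IsLocal (d + d') fun v => F (f v) (g v) := by
  classical
  obtain ⟨T, hT, hfT⟩ := hf
  obtain ⟨T', hT', hgT⟩ := hg
  refine ⟨T ∪ T', (Finset.card_union_le _ _).trans (Nat.add_le_add hT hT'), fun v w hvw => ?_⟩
  change F (f v) (g v) = F (f w) (g w)
  rw [hfT fun i hi => hvw i (by simp only [Finset.coe_union]; exact Or.inl hi),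
    hgT fun i hi => hvw i (by simp only [Finset.coe_union]; exact Or.inr hi)]

/-- Some coordinate is irrelevant. If it is the last, the columns coincide; otherwise setting it to
`0` moves the corner row to one covered by the hypothesis. -/
theorem IsLocal.eq_of_forall_ne {d : ℕ} {f : (Fin (n + 1) → Bool) → X} (hf : IsLocal d f)
    (hd : d ≤ n) (h : ∀ r : Fin n → Bool, r ≠ (fun _ => true) →
      f (Fin.snoc r false) = f (Fin.snoc r true)) :
    f (Fin.snoc (fun _ => true) false) = f (Fin.snoc (fun _ => true) true) := by
  obtain ⟨T, hT, hfT⟩ := hf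
  obtain ⟨i, hi⟩ : ∃ i, i ∉ T := by
    by_contra! hall
    have : T = Finset.univ := Finset.eq_univ_of_forall hall
    rw [this, Finset.card_univ, Fintype.card_fin] at hT
    omega
  revert hi
  refine Fin.lastCases (fun hi => ?_) (fun i hi => ?_) i
  · refine hfT fun j => ?_
    refine Fin.lastCases (fun hj => absurd hj hi) (fun j _ => ?_) j
    rw [Fin.snoc_castSucc, Fin.snoc_castSucc]
  · have key : ∀ b, f (Fin.snoc (fun _ => true) b) =
        f (Fin.snoc (Function.update (fun _ => true) i false) b) := by
      refine fun b => hfT fun j => ?_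
      refine Fin.lastCases (fun hj => ?_) (fun j hj => ?_) j
      · rw [Fin.snoc_last, Fin.snoc_last]
      · rw [Fin.snoc_castSucc, Fin.snoc_castSucc, Function.update_of_ne]
        rintro rfl
        exact hi hj
    rw [key, key]
    refine h _ fun heq => ?_
    have := congrFun heq i
    simp at this

/-- The quotient of the two columns lies at level `1` of an `n`-dimensional cube and is trivial off
the corner, so its corner value is in term `n + 1` of the slowed series, that is, in term `n / D` of
the lower central series. -/
theorem eq_of_mem_closure_isLocal {G : Type u} [Group G] {D c : ℕ} (hD : 0 < D)
    (hc : (⊤ : Subgroup G).lowerCentralSeries c = ⊥) (hn : c ≤ n / D)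
    {f : (Fin (n + 1) → Bool) → G} (hf : f ∈ Subgroup.closure {f | IsLocal D f})
    (h : ∀ r : Fin n → Bool, r ≠ (fun _ => true) →
      f (Fin.snoc r false) = f (Fin.snoc r true)) :
    f (Fin.snoc (fun _ => true) false) = f (Fin.snoc (fun _ => true) true) := by
  have hle : Subgroup.closure {f | IsLocal D f} ≤
      ((slowCentralSeries G hD).cube (n + 1)).term 0 := by
    refine (Subgroup.closure_le _).2 ?_
    rintro g ⟨T, hT, hgT⟩
    refine GroupFiltration.mem_cube_of_dependsOn _ hgT fun v => ?_
    change g v ∈ (⊤ : Subgroup G).lowerCentralSeries ((T.card + 0 - 1) / D)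
    rw [Nat.div_eq_of_lt (by omega)]
    trivial
  have h1 := GroupFiltration.apply_mem_of_mem_cube _ (hle hf).2 fun r hr =>
    show (f (Fin.snoc r false))⁻¹ * f (Fin.snoc r true) = 1 by rw [h r hr, inv_mul_cancel]
  change _ ∈ (⊤ : Subgroup G).lowerCentralSeries (n / D) at h1
  have h2 := (⊤ : Subgroup G).lowerCentralSeries_antitone hn h1
  rw [hc, Subgroup.mem_bot] at h2
  exact inv_mul_eq_one.1 h2

end Local

/-! ### Supernilpotence of the extension -/

section Cubes

variable {S : Type u} [Semigroup S]

/-- The products of `k + 1` elements of `A`. -/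
def productsOf (A : Set S) : ℕ → Set S
  | 0 => A
  | k + 1 => {z | ∃ x ∈ productsOf A k, ∃ y ∈ A, z = x * y}

theorem mul_mem_productsOf {A : Set S} {i j : ℕ} {x y : S} (hx : x ∈ productsOf A i)
    (hy : y ∈ productsOf A j) : x * y ∈ productsOf A (i + j + 1) := by
  induction j generalizing y with
  | zero => exact ⟨x, hx, y, hy, rfl⟩
  | succ j ih =>
    obtain ⟨a, ha, b, hb, rfl⟩ := hy
    exact ⟨x * a, ih ha, b, hb, (mul_assoc _ _ _).symm⟩

theorem exists_mul_of_mem_productsOf {A : Set S} {i j : ℕ} {x : S}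
    (hx : x ∈ productsOf A (i + j + 1)) :
    ∃ y ∈ productsOf A i, ∃ z ∈ productsOf A j, x = y * z := by
  induction j generalizing x with
  | zero => exact hx
  | succ j ih =>
    obtain ⟨y, hy, z, hz, rfl⟩ := hx
    obtain ⟨a, ha, b, hb, rfl⟩ := ih hy
    exact ⟨a, ha, b * z, ⟨b, hb, z, hz, rfl⟩, mul_assoc _ _ _⟩

theorem exists_mem_productsOf {A : Set S} {x : S} (hx : x ∈ Subsemigroup.closure A) :
    ∃ k, x ∈ productsOf A k := by
  induction hx using Subsemigroup.closure_induction with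
  | mem x hx => exact ⟨0, hx⟩
  | mul x y _ _ hx hy =>
    obtain ⟨i, hi⟩ := hx
    obtain ⟨j, hj⟩ := hy
    exact ⟨_, mul_mem_productsOf hi hj⟩

variable {n : ℕ} {x : (Fin n → Bool) → S} {k m : ℕ}

theorem isLocal_of_mem_productsOf (hx : x ∈ productsOf {x : (Fin n → Bool) → S | IsLocal 1 x} k) :
    IsLocal (k + 1) x := by
  induction k generalizing x with
  | zero => exact hx
  | succ k ih =>
    obtain ⟨y, hy, z, hz, rfl⟩ := hx
    exact (ih hy).map₂ hz (· * ·)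

theorem apply_mem_prodSet {A : Set ((Fin n → Bool) → S)} (hx : x ∈ productsOf A k)
    (v : Fin n → Bool) : x v ∈ prodSet S k := by
  induction k generalizing x with
  | zero => trivial
  | succ k ih =>
    obtain ⟨y, hy, z, hz, rfl⟩ := hx
    exact ⟨y v, ih hy, z v, rfl⟩

theorem prodSet_antitone : Antitone (prodSet S) := antitone_nat_of_succ_le prodSet_succ_subset

variable {e : S} {K : Set S}

/-- The first `m + 1` factors already multiply into `K` and fix the left coordinate; each of them
depends on one cube coordinate. -/
theorem isLocal_rho (h : IsGroupKernel e K) (hm : prodSet S m ⊆ K) (hmk : m ≤ k)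
    (hx : x ∈ productsOf {x : (Fin n → Bool) → S | IsLocal 1 x} k) :
    IsLocal (m + 1) fun v => h.rho (x v) := by
  rcases hmk.eq_or_lt with rfl | hlt
  · exact (isLocal_of_mem_productsOf hx).map h.rho
  · obtain ⟨j, rfl⟩ := Nat.exists_eq_add_of_lt hlt
    obtain ⟨y, hy, z, hz, rfl⟩ := exists_mul_of_mem_productsOf hx
    convert (isLocal_of_mem_productsOf hy).map h.rho using 2 with v
    exact h.rho_mul (hm (apply_mem_prodSet hy v)) _

theorem isLocal_lam (h : IsGroupKernel e K) (hm : prodSet S m ⊆ K) (hmk : m ≤ k)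
    (hx : x ∈ productsOf {x : (Fin n → Bool) → S | IsLocal 1 x} k) :
    IsLocal (m + 1) fun v => h.lam (x v) := by
  rcases hmk.eq_or_lt with rfl | hlt
  · exact (isLocal_of_mem_productsOf hx).map h.lam
  · obtain ⟨j, rfl⟩ := Nat.exists_eq_add_of_lt hlt
    rw [Nat.add_comm m j] at hx
    obtain ⟨y, hy, z, hz, rfl⟩ := exists_mul_of_mem_productsOf hx
    convert (isLocal_of_mem_productsOf hz).map h.lam using 2 with v
    exact h.lam_mul (hm (apply_mem_prodSet hz v)) _

/-- Cut off the first `m + 1` factors while at least `m + 1` remain. Both pieces take values in `K`,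
and the sandwich entry between them involves at most `m + 1` coordinates from each side. -/
theorem proj_mem_closure_isLocal (h : IsGroupKernel e K) (hm : prodSet S m ⊆ K) (hmk : m ≤ k)
    (hx : x ∈ productsOf {x : (Fin n → Bool) → S | IsLocal 1 x} k) :
    (fun v => h.proj (x v)) ∈
      Subgroup.closure {f : (Fin n → Bool) → h.Corner | IsLocal (m + 1 + (m + 1)) f} := by
  induction k using Nat.strong_induction_on generalizing x with
  | _ k ih =>
    rcases Nat.lt_or_ge k (m + 1 + (m + 1)) with hk | hk
    · exact Subgroup.subset_closure (((isLocal_of_mem_productsOf hx).map h.proj).mono hk)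
    · obtain ⟨j, rfl⟩ := Nat.exists_eq_add_of_lt (show m < k by omega)
      obtain ⟨y, hy, z, hz, rfl⟩ := exists_mul_of_mem_productsOf hx
      have hmid : IsLocal (m + 1 + (m + 1)) fun v => h.proj (h.lam (y v) * h.rho (z v)) :=
        (isLocal_lam h hm le_rfl hy).map₂ (isLocal_rho h hm (by omega) hz)
          fun a b => h.proj (a * b)
      have hy' := ih m (by omega) le_rfl hy
      have hz' := ih j (by omega) (by omega) hz
      convert mul_mem (mul_mem hy' (Subgroup.subset_closure hmid)) hz' using 1
      ext v : 1
      exact h.proj_mul (hm (apply_mem_prodSet hy v))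
        (hm (prodSet_antitone (show m ≤ j by omega) (apply_mem_prodSet hz v)))

theorem supernilpotent_of_isGroupKernel (h : IsGroupKernel e K) (hm : prodSet S m ⊆ K)
    (hG : Group.IsNilpotent h.Corner) : Supernilpotent S := by
  obtain ⟨c, hc⟩ := Subgroup.nilpotent_iff_lowerCentralSeries.1 hG
  set D := m + 1 + (m + 1) with hD
  have hDpos : 0 < D := by omega
  -- The factor `c + 1` instead of `c` keeps the dimension above `D` even for a trivial corner
  -- group, as the arguments for `rho`, `lam` and short products need.
  refine ⟨(c + 1) * D, le_bot_iff.1 (higherCommutator_le fun x hx hr => ?_)⟩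
  have hDle : D ≤ (c + 1) * D := Nat.le_mul_of_pos_left D (Nat.succ_pos c)
  have hgen : x ∈ Subsemigroup.closure
      {x : (Fin ((c + 1) * D + 1) → Bool) → S | IsLocal 1 x} := by
    refine Subsemigroup.closure_mono ?_ hx
    rintro _ ⟨i, a, b, -, rfl⟩
    refine ⟨{i}, by simp, fun v w hvw => ?_⟩
    simp only [hvw i (by simp)]
  obtain ⟨k, hk⟩ := exists_mem_productsOf hgen
  simp only [bot_rel] at hr ⊢
  rcases Nat.lt_or_ge k m with hkm | hkm
  · exact (isLocal_of_mem_productsOf hk).eq_of_forall_ne (by omega) hr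
  · have hK : ∀ v, x v ∈ K := fun v => hm (prodSet_antitone hkm (apply_mem_prodSet hk v))
    refine h.ext (hK _) (hK _) ?_ ?_ ?_
    · exact (isLocal_rho h hm hkm hk).eq_of_forall_ne (by omega) fun r hr' => by rw [hr r hr']
    · exact (isLocal_lam h hm hkm hk).eq_of_forall_ne (by omega) fun r hr' => by rw [hr r hr']
    · refine eq_of_mem_closure_isLocal hDpos hc ?_ (proj_mem_closure_isLocal h hm hkm hk)
        fun r hr' => by rw [hr r hr']
      rw [Nat.mul_div_cancel _ hDpos]; exact Nat.le_succ c

end Cubes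

end SemigroupCommutator

/-! ### Assembly of the equivalences -/

theorem corollary1p2 {S : Type*} [Semigroup S] [Nonempty S]
    (hS : SemigroupCommutator.EventuallyRegular S) :
    (SemigroupCommutator.Solvable S ↔
      ∃ K : Subsemigroup S, SemigroupCommutator.IsNilpotentExtensionOf S K ∧
        SemigroupCommutator.CompletelySimple K ∧ SemigroupCommutator.SubgroupsSolvable K) ∧
    List.TFAE
      [SemigroupCommutator.LeftNilpotent S,
        SemigroupCommutator.RightNilpotent S,
        SemigroupCommutator.Supernilpotent S,
        ∃ K : Subsemigroup S, SemigroupCommutator.IsNilpotentExtensionOf S K ∧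
          SemigroupCommutator.CompletelySimple K ∧
          SemigroupCommutator.SubgroupsNilpotent K] := by
  open SemigroupCommutator in
  refine ⟨⟨exists_subsemigroup_of_solvable hS, ?_⟩, ?_⟩
  · rintro ⟨K, ⟨hid, n, hn⟩, hK, hG⟩
    obtain ⟨e, h⟩ := exists_isGroupKernel_of_completelySimple hid hK
    exact solvable_of_isGroupKernel h hn (hG _ _ (cornerHom_injective h))
  · tfae_have 1 → 4 := exists_subsemigroup_of_leftNilpotent hS
    tfae_have 2 → 4 := exists_subsemigroup_of_rightNilpotent hS
    tfae_have 3 → 4 := exists_subsemigroup_of_supernilpotent hS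
    tfae_have 4 → 1 := by
      rintro ⟨K, ⟨hid, n, hn⟩, hK, hG⟩
      obtain ⟨e, h⟩ := exists_isGroupKernel_of_completelySimple hid hK
      exact leftNilpotent_of_isGroupKernel h hn (hG _ _ (cornerHom_injective h))
    tfae_have 4 → 2 := by
      rintro ⟨K, ⟨hid, n, hn⟩, hK, hG⟩
      obtain ⟨e, h⟩ := exists_isGroupKernel_of_completelySimple hid hK
      exact rightNilpotent_of_isGroupKernel h hn (hG _ _ (cornerHom_injective h))
    tfae_have 4 → 3 := by
      rintro ⟨K, ⟨hid, n, hn⟩, hK, hG⟩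
      obtain ⟨e, h⟩ := exists_isGroupKernel_of_completelySimple hid hK
      exact supernilpotent_of_isGroupKernel h hn (hG _ _ (cornerHom_injective h))
    tfae_finish
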